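/- Let $\eta\in\mathbb C$, $q=e^{\eta}$, and assume that $q$ is not a root of unity; write $q^{z}=e^{\eta z}$. Put $[n]_q=\frac{q^n-q^{-n}}{q-q^{-1}}$, $(n)_q=q^{n-1}[n]_q$, $(n)_q!=(n)_q\cdots(1)_q$ and $\exp_q(z)=\sum_{n\ge 0} z^n/(n)_q!$. Let $U_q(sl(2))$ be generated by $E_+,E_-,h$ (and $q^{\pm h/2}$) with $$[h,E_\pm]=\pm2E_\pm,\qquad [E_+,E_-]=\frac{q^h-q^{-h}}{q-q^{-1}},\qquad \Delta(E_\pm)=E_\pm\otimes q^{h/2}+q^{-h/2}\otimes E_\pm,\qquad \Delta(h)=h\otimes1+1\otimes h,$$ and set $e=q^{h/2}E_+$, $f=E_-q^{-h/2}$. In a finite-dimensional representation (over $\mathbb C$) $q^{h/2}$ acts as $\exp(\tfrac{\eta}{2}h)$. Subscripts $1,2$ denote the tensor factor in which an element acts, and $Q_1(xq^{h_2})$ is obtained from $Q_1(x)$ by replacing $x$ with $xq^{h_2}=x(1\otimes q^{h})$. For $x\in\mathbb C^*$ let $$N(x)=N_-(x)N_+(x),\qquad N_+(x)=\exp_{q^{-1}}(-x\,e),\qquad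 N_-(x)=\prod_{k=\infty}^{0}\exp_{q^{-1}}\!\big(q^{-(2k+1)(h+1)}x^{-2k-1}f\big)$$ (factors with larger $k$ stand to the left), and let $F$ be Babelon's dynamical twist $$F(x)=\sum_{k\ge0}\frac{(-1)^k(q-q^{-1})^k}{(k)_{q^{-1}}!}\,\frac{q^{k(1-k)}}{\prod_{p=k}^{2k-1}\big(1-x^{-2}q^{-2p-2h_2}\big)}\,e^k\otimes f^k ,$$ where a term in which $e^k\otimes f^k$ acts as $0$ is read as $0$. Let $V,W$ be finite-dimensional representations of $U_q(sl(2))$. Then there is $r>0$ such that for all $x\in\mathbb C$ with $|x|>r$ the following hold. 1. $F(x)$ is well defined on $V\otimes W$ (the denominators of the terms with $e^k\otimes f^k\neq 0$ are invertible there), and it is also given by the convergent product $$F(x)=\prod_{k=0}^{\infty}\exp_q\!\big(-(q-q^{-1})x^{-2k}q^{-2k(1+h_2)}e\otimes f\big)$$ (factors with larger $k$ stand to the right). 2. All series and infinite products defining $N(x)$ on $V$, on $W$ and on $V\otimes W$ (that is, $\Delta(N(x))$), as well as $N_2(x)$ and $N_1(xq^{h_2})$ on $V\otimes W$, converge, and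 $N_2(x)$, $N_1(xq^{h_2})$ are invertible. 3. The dynamical coboundary equation holds on $V\otimes W$: $$F(x)=\Delta(N(x))\,N_2(x)^{-1}\,N_1(xq^{h_2})^{-1}.$$ -/

import Mathlib

open Filter Topology
open scoped TensorProduct Kronecker

noncomputable section

/-! ### `q`-numbers and the `q`-exponential -/

/-- `[n]_q = (q^n - q^{-n}) / (q - q^{-1})`. -/
def qBracket (q : ℂ) (n : ℕ) : ℂ := (q ^ n - (q ^ n)⁻¹) / (q - q⁻¹)

/-- `(n)_q = q^{n-1} [n]_q`. -/
def qParen (q : ℂ) (n : ℕ) : ℂ := q ^ ((n : ℤ) - 1) * qBracket q n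

/-- `(n)_q! = (n)_q ⋯ (1)_q`. -/
def qParenFactorial (q : ℂ) (n : ℕ) : ℂ := ∏ i ∈ Finset.range n, qParen q (i + 1)

/-- The `n`-th term `a^n / (n)_q!` of the `q`-exponential series. -/
def qExpTerm {n : Type*} [Fintype n] [DecidableEq n] (q : ℂ) (a : Matrix n n ℂ) (k : ℕ) :
    Matrix n n ℂ :=
  (qParenFactorial q k)⁻¹ • a ^ k

/-- `exp_q(a) = ∑_k a^k / (k)_q!`. -/
def qExp {n : Type*} [Fintype n] [DecidableEq n] (q : ℂ) (a : Matrix n n ℂ) : Matrix n n ℂ :=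
  ∑' k, qExpTerm q a k

/-- `A 0 * A 1 * ⋯ * A (m - 1)`. -/
def ascProd {R : Type*} [Monoid R] (A : ℕ → R) : ℕ → R
  | 0 => 1
  | m + 1 => ascProd A m * A m

/-- `A (m - 1) * ⋯ * A 1 * A 0`. -/
def descProd {R : Type*} [Monoid R] (A : ℕ → R) : ℕ → R
  | 0 => 1
  | m + 1 => A m * descProd A m

/-! ### The algebra `U_q(sl(2))` and its coproduct -/

/-- The generators `E_+`, `E_-`, `h` and `K = q^{h/2}`, `Kinv = q^{-h/2}`. -/
inductive UqGen : Type
  | Ep | Em | h | K | Kinv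

open FreeAlgebra in
/-- The defining relations of `U_q(sl(2))`. -/
inductive UqRel (q : ℂ) : FreeAlgebra ℂ UqGen → FreeAlgebra ℂ UqGen → Prop
  | K_Kinv : UqRel q (ι ℂ .K * ι ℂ .Kinv) 1
  | Kinv_K : UqRel q (ι ℂ .Kinv * ι ℂ .K) 1
  | h_K : UqRel q (ι ℂ .h * ι ℂ .K) (ι ℂ .K * ι ℂ .h)
  | K_Ep : UqRel q (ι ℂ .K * ι ℂ .Ep) (q • (ι ℂ .Ep * ι ℂ .K))
  | K_Em : UqRel q (ι ℂ .K * ι ℂ .Em) (q⁻¹ • (ι ℂ .Em * ι ℂ .K))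
  | h_Ep : UqRel q (ι ℂ .h * ι ℂ .Ep - ι ℂ .Ep * ι ℂ .h) ((2 : ℂ) • ι ℂ .Ep)
  | h_Em : UqRel q (ι ℂ .h * ι ℂ .Em - ι ℂ .Em * ι ℂ .h) ((-2 : ℂ) • ι ℂ .Em)
  | Ep_Em : UqRel q (ι ℂ .Ep * ι ℂ .Em - ι ℂ .Em * ι ℂ .Ep)
      ((q - q⁻¹)⁻¹ • (ι ℂ .K ^ 2 - ι ℂ .Kinv ^ 2))

/-- `U_q(sl(2))`, generated by `E_±`, `h` and `q^{±h/2}`, with `[h, E_±] = ±2 E_±` and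
`[E_+, E_-] = [h]_q = (q^h - q^{-h}) / (q - q^{-1})`. -/
abbrev Uq (q : ℂ) : Type := RingQuot (UqRel q)

namespace Uq

/-- The class of a generator in `U_q(sl(2))`. -/
def gen (q : ℂ) (g : UqGen) : Uq q := RingQuot.mkAlgHom ℂ (UqRel q) (FreeAlgebra.ι ℂ g)

/-- `e = q^{h/2} E_+`. -/
def e (q : ℂ) : Uq q := gen q .K * gen q .Ep

/-- `f = E_- q^{-h/2}`. -/
def f (q : ℂ) : Uq q := gen q .Em * gen q .Kinv

/-- The coproduct on generators: `Δ(E_±) = E_± ⊗ q^{h/2} + q^{-h/2} ⊗ E_±`, with `h` primitive and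
`q^{±h/2}` group-like. -/
def comulGen (q : ℂ) : UqGen → Uq q ⊗[ℂ] Uq q
  | .Ep => gen q .Ep ⊗ₜ gen q .K + gen q .Kinv ⊗ₜ gen q .Ep
  | .Em => gen q .Em ⊗ₜ gen q .K + gen q .Kinv ⊗ₜ gen q .Em
  | .h => gen q .h ⊗ₜ 1 + 1 ⊗ₜ gen q .h
  | .K => gen q .K ⊗ₜ gen q .K
  | .Kinv => gen q .Kinv ⊗ₜ gen q .Kinv

theorem rel (q : ℂ) {a b : FreeAlgebra ℂ UqGen} (H : UqRel q a b) :
    RingQuot.mkAlgHom ℂ (UqRel q) a = RingQuot.mkAlgHom ℂ (UqRel q) b :=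
  RingQuot.mkAlgHom_rel ℂ H

theorem K_Kinv (q : ℂ) : gen q .K * gen q .Kinv = 1 := by
  simpa [gen] using rel q .K_Kinv

theorem Kinv_K (q : ℂ) : gen q .Kinv * gen q .K = 1 := by
  simpa [gen] using rel q .Kinv_K

theorem h_K (q : ℂ) : gen q .h * gen q .K = gen q .K * gen q .h := by
  simpa [gen] using rel q .h_K

theorem K_Ep (q : ℂ) : gen q .K * gen q .Ep = q • (gen q .Ep * gen q .K) := by
  simpa [gen] using rel q .K_Ep

theorem K_Em (q : ℂ) : gen q .K * gen q .Em = q⁻¹ • (gen q .Em * gen q .K) := by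
  simpa [gen] using rel q .K_Em

theorem h_Ep (q : ℂ) :
    gen q .h * gen q .Ep - gen q .Ep * gen q .h = (2 : ℂ) • gen q .Ep := by
  simpa only [gen, map_sub, map_mul, map_smul] using rel q .h_Ep

theorem h_Em (q : ℂ) :
    gen q .h * gen q .Em - gen q .Em * gen q .h = (-2 : ℂ) • gen q .Em := by
  simpa only [gen, map_sub, map_mul, map_smul] using rel q .h_Em

theorem Ep_Em (q : ℂ) : gen q .Ep * gen q .Em - gen q .Em * gen q .Ep =
    (q - q⁻¹)⁻¹ • (gen q .K ^ 2 - gen q .Kinv ^ 2) := by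
  simpa only [gen, map_sub, map_mul, map_smul, map_pow] using rel q .Ep_Em

theorem h_Kinv (q : ℂ) : gen q .h * gen q .Kinv = gen q .Kinv * gen q .h := by
  calc gen q .h * gen q .Kinv
      = gen q .Kinv * gen q .K * (gen q .h * gen q .Kinv) := by rw [Kinv_K, one_mul]
    _ = gen q .Kinv * (gen q .h * gen q .K) * gen q .Kinv := by rw [h_K]; simp only [mul_assoc]
    _ = gen q .Kinv * gen q .h * (gen q .K * gen q .Kinv) := by simp only [mul_assoc]
    _ = gen q .Kinv * gen q .h := by rw [K_Kinv, mul_one]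

theorem Ep_Kinv (q : ℂ) : gen q .Ep * gen q .Kinv = q • (gen q .Kinv * gen q .Ep) := by
  calc gen q .Ep * gen q .Kinv
      = gen q .Kinv * (gen q .K * gen q .Ep) * gen q .Kinv := by
        rw [← mul_assoc, Kinv_K, one_mul]
    _ = q • (gen q .Kinv * gen q .Ep * (gen q .K * gen q .Kinv)) := by
        rw [K_Ep]; simp only [mul_assoc, smul_mul_assoc, mul_smul_comm]
    _ = q • (gen q .Kinv * gen q .Ep) := by rw [K_Kinv, mul_one]

theorem Em_Kinv (q : ℂ) : gen q .Em * gen q .Kinv = q⁻¹ • (gen q .Kinv * gen q .Em) := by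
  calc gen q .Em * gen q .Kinv
      = gen q .Kinv * (gen q .K * gen q .Em) * gen q .Kinv := by
        rw [← mul_assoc, Kinv_K, one_mul]
    _ = q⁻¹ • (gen q .Kinv * gen q .Em * (gen q .K * gen q .Kinv)) := by
        rw [K_Em]; simp only [mul_assoc, smul_mul_assoc, mul_smul_comm]
    _ = q⁻¹ • (gen q .Kinv * gen q .Em) := by rw [K_Kinv, mul_one]

theorem comulGen_rel (q : ℂ) (hq : q ≠ 0) {a b : FreeAlgebra ℂ UqGen} (H : UqRel q a b) :
    FreeAlgebra.lift ℂ (comulGen q) a = FreeAlgebra.lift ℂ (comulGen q) b := by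
  have hqq : q * q⁻¹ = 1 := mul_inv_cancel₀ hq
  have hqq' : q⁻¹ * q = 1 := inv_mul_cancel₀ hq
  cases H <;>
    simp only [map_sub, map_mul, map_smul, map_one, FreeAlgebra.lift_ι_apply, comulGen,
      mul_add, add_mul, Algebra.TensorProduct.tmul_mul_tmul,
      one_mul, mul_one, K_Kinv, Kinv_K, h_K, smul_add, pow_two]
  case K_Kinv => rfl
  case Kinv_K => rfl
  case K_Ep =>
    rw [K_Ep, TensorProduct.smul_tmul', TensorProduct.tmul_smul]
  case K_Em =>
    rw [K_Em, TensorProduct.smul_tmul', TensorProduct.tmul_smul]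
  case h_Ep =>
    rw [h_Kinv, TensorProduct.smul_tmul', ← TensorProduct.tmul_smul, ← h_Ep,
      TensorProduct.sub_tmul, TensorProduct.tmul_sub]
    abel
  case h_Em =>
    rw [h_Kinv, TensorProduct.smul_tmul', ← TensorProduct.tmul_smul, ← h_Em,
      TensorProduct.sub_tmul, TensorProduct.tmul_sub]
    abel
  case Ep_Em =>
    have h1 : (gen q .Ep * gen q .Kinv) ⊗ₜ[ℂ] (gen q .K * gen q .Em) =
        (gen q .Kinv * gen q .Ep) ⊗ₜ[ℂ] (gen q .Em * gen q .K) := by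
      rw [Ep_Kinv, K_Em, ← TensorProduct.smul_tmul', TensorProduct.tmul_smul, smul_smul, hqq,
        one_smul]
    have h2 : (gen q .Em * gen q .Kinv) ⊗ₜ[ℂ] (gen q .K * gen q .Ep) =
        (gen q .Kinv * gen q .Em) ⊗ₜ[ℂ] (gen q .Ep * gen q .K) := by
      rw [Em_Kinv, K_Ep, ← TensorProduct.smul_tmul', TensorProduct.tmul_smul, smul_smul, hqq',
        one_smul]
    have h3 := Ep_Em q
    rw [pow_two, pow_two] at h3
    have h4 : gen q .Ep * gen q .Em = gen q .Em * gen q .Ep +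
        (q - q⁻¹)⁻¹ • (gen q .K * gen q .K - gen q .Kinv * gen q .Kinv) := by
      rw [← h3]; abel
    rw [h1, h2, h4, TensorProduct.add_tmul, TensorProduct.tmul_add, ← TensorProduct.smul_tmul',
      TensorProduct.tmul_smul, TensorProduct.sub_tmul, TensorProduct.tmul_sub, smul_sub, smul_sub,
      smul_sub]
    abel

/-- The coproduct `Δ : U_q(sl(2)) → U_q(sl(2)) ⊗ U_q(sl(2))`. -/
def comul (q : ℂ) (hq : q ≠ 0) : Uq q →ₐ[ℂ] Uq q ⊗[ℂ] Uq q :=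
  RingQuot.liftAlgHom ℂ ⟨FreeAlgebra.lift ℂ (comulGen q), fun _ _ H => comulGen_rel q hq H⟩

end Uq

/-! ### Finite-dimensional representations

Throughout, `q = exp η`, and `q^{c h}` acts in a finite-dimensional representation as the matrix
exponential `exp (c η h)`. -/

/-- A finite-dimensional (complex) representation of `U_q(sl(2))`, `q = exp η`, written in a basis
indexed by `m`; the generator `K = q^{h/2}` acts as the exponential of `(η / 2) h`. -/
structure UqRep (η : ℂ) (m : Type*) [Fintype m] [DecidableEq m] where
  /-- The action. -/
  toHom : Uq (Complex.exp η) →ₐ[ℂ] Matrix m m ℂ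
  map_K : toHom (Uq.gen _ .K) = NormedSpace.exp ((η / 2) • toHom (Uq.gen _ .h))

/-- `A ↦ A ⊗ 1`. -/
def kronLeft (ι κ : Type*) [Fintype ι] [DecidableEq ι] [Fintype κ] [DecidableEq κ] :
    Matrix ι ι ℂ →ₐ[ℂ] Matrix (ι × κ) (ι × κ) ℂ where
  toFun A := A ⊗ₖ (1 : Matrix κ κ ℂ)
  map_one' := Matrix.one_kronecker_one
  map_mul' A B := by rw [← Matrix.mul_kronecker_mul, one_mul]
  map_zero' := Matrix.zero_kronecker _
  map_add' A B := Matrix.add_kronecker A B _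
  commutes' c := by
    rw [Algebra.algebraMap_eq_smul_one, Algebra.algebraMap_eq_smul_one, Matrix.smul_kronecker,
      Matrix.one_kronecker_one]

/-- `B ↦ 1 ⊗ B`. -/
def kronRight (ι κ : Type*) [Fintype ι] [DecidableEq ι] [Fintype κ] [DecidableEq κ] :
    Matrix κ κ ℂ →ₐ[ℂ] Matrix (ι × κ) (ι × κ) ℂ where
  toFun B := (1 : Matrix ι ι ℂ) ⊗ₖ B
  map_one' := Matrix.one_kronecker_one
  map_mul' A B := by rw [← Matrix.mul_kronecker_mul, one_mul]
  map_zero' := Matrix.kronecker_zero _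
  map_add' A B := Matrix.kronecker_add _ A B
  commutes' c := by
    rw [Algebra.algebraMap_eq_smul_one, Algebra.algebraMap_eq_smul_one, Matrix.kronecker_smul,
      Matrix.one_kronecker_one]

/-- The action of `U_q(sl(2)) ⊗ U_q(sl(2))` on the tensor product `V ⊗ W` of two representations:
`a ⊗ b` acts as the Kronecker product `V(a) ⊗ₖ W(b)`. -/
def tensorAction {η : ℂ} {ι κ : Type*} [Fintype ι] [DecidableEq ι] [Fintype κ] [DecidableEq κ]
    (V : UqRep η ι) (W : UqRep η κ) :
    Uq (Complex.exp η) ⊗[ℂ] Uq (Complex.exp η) →ₐ[ℂ] Matrix (ι × κ) (ι × κ) ℂ :=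
  Algebra.TensorProduct.lift ((kronLeft ι κ).comp V.toHom) ((kronRight ι κ).comp W.toHom)
    (fun a b => by
      change V.toHom a ⊗ₖ (1 : Matrix κ κ ℂ) * (1 : Matrix ι ι ℂ) ⊗ₖ W.toHom b =
        (1 : Matrix ι ι ℂ) ⊗ₖ W.toHom b * V.toHom a ⊗ₖ (1 : Matrix κ κ ℂ)
      simp only [← Matrix.mul_kronecker_mul, one_mul, mul_one])

theorem tensorAction_tmul {η : ℂ} {ι κ : Type*} [Fintype ι] [DecidableEq ι] [Fintype κ]
    [DecidableEq κ] (V : UqRep η ι) (W : UqRep η κ) (a b : Uq (Complex.exp η)) :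
    tensorAction V W (a ⊗ₜ b) = V.toHom a ⊗ₖ W.toHom b := by
  change V.toHom a ⊗ₖ (1 : Matrix κ κ ℂ) * (1 : Matrix ι ι ℂ) ⊗ₖ W.toHom b = _
  rw [← Matrix.mul_kronecker_mul, one_mul, mul_one]

/-- The action of `U_q(sl(2))` on `V ⊗ W` through the coproduct `Δ`. -/
def actΔ {η : ℂ} {ι κ : Type*} [Fintype ι] [DecidableEq ι] [Fintype κ] [DecidableEq κ]
    (V : UqRep η ι) (W : UqRep η κ) :
    Uq (Complex.exp η) →ₐ[ℂ] Matrix (ι × κ) (ι × κ) ℂ :=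
  (tensorAction V W).comp (Uq.comul _ (Complex.exp_ne_zero η))

open scoped Matrix.Norms.Operator in
theorem actΔ_map_K {η : ℂ} {ι κ : Type*} [Fintype ι] [DecidableEq ι] [Fintype κ] [DecidableEq κ]
    (V : UqRep η ι) (W : UqRep η κ) :
    actΔ V W (Uq.gen _ .K) = NormedSpace.exp ((η / 2) • actΔ V W (Uq.gen _ .h)) := by
  have hK : actΔ V W (Uq.gen _ .K) = kronLeft ι κ (V.toHom (Uq.gen _ .K)) * kronRight ι κ (W.toHom (Uq.gen _ .K)) := by
    simp [actΔ, Uq.comul, Uq.gen, Uq.comulGen, tensorAction]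
  have hh : actΔ V W (Uq.gen _ .h) = kronLeft ι κ (V.toHom (Uq.gen _ .h)) + kronRight ι κ (W.toHom (Uq.gen _ .h)) := by
    simp [actΔ, Uq.comul, Uq.gen, Uq.comulGen, tensorAction]
  rw [hK, hh, V.map_K, W.map_K, smul_add, ← map_smul (kronLeft ι κ), ← map_smul (kronRight ι κ), Matrix.exp_add_of_commute]
  · congr 1
    · exact NormedSpace.map_exp (𝔸 := Matrix ι ι ℂ) (kronLeft ι κ) (kronLeft ι κ).toLinearMap.continuous_of_finiteDimensional _
    · exact NormedSpace.map_exp (𝔸 := Matrix κ κ ℂ) (kronRight ι κ) (kronRight ι κ).toLinearMap.continuous_of_finiteDimensional _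
  change (_ ⊗ₖ (1 : Matrix κ κ ℂ)) * ((1 : Matrix ι ι ℂ) ⊗ₖ _) = ((1 : Matrix ι ι ℂ) ⊗ₖ _) * (_ ⊗ₖ (1 : Matrix κ κ ℂ))
  simp only [← Matrix.mul_kronecker_mul, one_mul, mul_one]

/-- The tensor product representation `V ⊗ W`. -/
def UqRep.tensor {η : ℂ} {ι κ : Type*} [Fintype ι] [DecidableEq ι] [Fintype κ] [DecidableEq κ]
    (V : UqRep η ι) (W : UqRep η κ) : UqRep η (ι × κ) where
  toHom := actΔ V W
  map_K := actΔ_map_K V W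

/-- The action of `U_q(sl(2))` on the first factor of `V ⊗ W`, `a ↦ a_1 = a ⊗ 1`. -/
def act₁ {η : ℂ} {ι κ : Type*} [Fintype ι] [DecidableEq ι] [Fintype κ] [DecidableEq κ]
    (V : UqRep η ι) (W : UqRep η κ) :
    Uq (Complex.exp η) →ₐ[ℂ] Matrix (ι × κ) (ι × κ) ℂ :=
  (tensorAction V W).comp Algebra.TensorProduct.includeLeft

/-- The action of `U_q(sl(2))` on the second factor of `V ⊗ W`, `a ↦ a_2 = 1 ⊗ a`. -/
def act₂ {η : ℂ} {ι κ : Type*} [Fintype ι] [DecidableEq ι] [Fintype κ] [DecidableEq κ]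
    (V : UqRep η ι) (W : UqRep η κ) :
    Uq (Complex.exp η) →ₐ[ℂ] Matrix (ι × κ) (ι × κ) ℂ :=
  (tensorAction V W).comp Algebra.TensorProduct.includeRight

/-! ### The element `N(x)`

An element of (a completion of) `U_q(sl(2))` given by a series or an infinite product is evaluated
along an action `φ` of `U_q(sl(2))` by matrices. The variable `X` is a matrix commuting with the
action, so that besides scalars `x` also `x q^{h_2}` can be substituted in the first factor. -/

section N
variable {η : ℂ} {m : Type*} [Fintype m] [DecidableEq m]

/-- `-X e`, the argument of the `q`-exponential `N_+(X)`. -/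
def NPlusArg (φ : Uq (Complex.exp η) →ₐ[ℂ] Matrix m m ℂ) (X : Matrix m m ℂ) : Matrix m m ℂ :=
  -(X * φ (Uq.e _))

/-- `N_+(X) = exp_{q^{-1}}(-X e)`. -/
def NPlus (φ : Uq (Complex.exp η) →ₐ[ℂ] Matrix m m ℂ) (X : Matrix m m ℂ) : Matrix m m ℂ :=
  qExp (Complex.exp η)⁻¹ (NPlusArg φ X)

/-- `q^{-(2k+1)(h+1)} X^{-2k-1} f`. -/
def NMinusArg (φ : Uq (Complex.exp η) →ₐ[ℂ] Matrix m m ℂ) (X : Matrix m m ℂ) (k : ℕ) :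
    Matrix m m ℂ :=
  NormedSpace.exp ((-(2 * (k : ℂ) + 1) * η) • (φ (Uq.gen _ .h) + 1)) * X⁻¹ ^ (2 * k + 1) *
    φ (Uq.f _)

/-- The finite product `∏_{k = p-1}^{0} exp_{q^{-1}}(q^{-(2k+1)(h+1)} X^{-2k-1} f)`, the factor
`k = 0` being the rightmost one. -/
def NMinusPartial (φ : Uq (Complex.exp η) →ₐ[ℂ] Matrix m m ℂ) (X : Matrix m m ℂ) :
    ℕ → Matrix m m ℂ :=
  descProd fun k => qExp (Complex.exp η)⁻¹ (NMinusArg φ X k)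

/-- `N_-(X) = ∏_{k = ∞}^{0} exp_{q^{-1}}(q^{-(2k+1)(h+1)} X^{-2k-1} f)`. -/
def NMinus (φ : Uq (Complex.exp η) →ₐ[ℂ] Matrix m m ℂ) (X : Matrix m m ℂ) : Matrix m m ℂ :=
  limUnder atTop (NMinusPartial φ X)

/-- `N(X) = N_-(X) N_+(X)`. -/
def NElt (φ : Uq (Complex.exp η) →ₐ[ℂ] Matrix m m ℂ) (X : Matrix m m ℂ) : Matrix m m ℂ :=
  NMinus φ X * NPlus φ X

/-- All the series and the infinite product in the definition of `N(X)` converge. -/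
structure NConverges (φ : Uq (Complex.exp η) →ₐ[ℂ] Matrix m m ℂ) (X : Matrix m m ℂ) : Prop where
  isUnit : IsUnit X
  plus : Summable (qExpTerm (Complex.exp η)⁻¹ (NPlusArg φ X))
  factor : ∀ k, Summable (qExpTerm (Complex.exp η)⁻¹ (NMinusArg φ X k))
  prod : Tendsto (NMinusPartial φ X) atTop (𝓝 (NMinus φ X))

end N

/-! ### The dynamical twist -/

section Twist
variable {η : ℂ} {ι κ : Type*} [Fintype ι] [DecidableEq ι] [Fintype κ] [DecidableEq κ]

/-- `q^{c (h_2 + d)}` on `V ⊗ W`. -/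
def qPowH₂ (V : UqRep η ι) (W : UqRep η κ) (c d : ℂ) : Matrix (ι × κ) (ι × κ) ℂ :=
  NormedSpace.exp ((c * η) • (act₂ V W (Uq.gen _ .h) + d • 1))

/-- The factor `1 - x^{-2} q^{-2p-2h_2}`. -/
def twistDenFactor (V : UqRep η ι) (W : UqRep η κ) (x : ℂ) (p : ℕ) :
    Matrix (ι × κ) (ι × κ) ℂ :=
  1 - (x ^ 2)⁻¹ • qPowH₂ V W (-2) p

/-- The denominator `∏_{p=k}^{2k-1} (1 - x^{-2} q^{-2p-2h_2})` of the `k`-th coefficient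
(the factors commute). -/
def twistDen (V : UqRep η ι) (W : UqRep η κ) (x : ℂ) (k : ℕ) : Matrix (ι × κ) (ι × κ) ℂ :=
  ascProd (fun i => twistDenFactor V W x (k + i)) k

/-- The `k`-th term of Babelon's series,
`(-1)^k (q - q^{-1})^k q^{k(1-k)} / ((k)_{q^{-1}}! ∏_{p=k}^{2k-1} (1 - x^{-2} q^{-2p-2h_2})) e^k ⊗ f^k`. -/
def twistTerm (V : UqRep η ι) (W : UqRep η κ) (x : ℂ) (k : ℕ) : Matrix (ι × κ) (ι × κ) ℂ :=
  ((-1) ^ k * (Complex.exp η - (Complex.exp η)⁻¹) ^ k / qParenFactorial (Complex.exp η)⁻¹ k *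
      Complex.exp η ^ ((k : ℤ) * (1 - k))) •
    ((twistDen V W x k)⁻¹ * tensorAction V W ((Uq.e _ ^ k) ⊗ₜ (Uq.f _ ^ k)))

/-- Babelon's dynamical twist `F(x)`, acting on `V ⊗ W`. -/
def twist (V : UqRep η ι) (W : UqRep η κ) (x : ℂ) : Matrix (ι × κ) (ι × κ) ℂ :=
  ∑' k, twistTerm V W x k

/-- The series `F(x)` makes sense on `V ⊗ W`: the denominators of all the terms in which
`e^k ⊗ f^k` does not vanish are invertible, and the series converges. -/
structure TwistConverges (V : UqRep η ι) (W : UqRep η κ) (x : ℂ) : Prop where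
  den : ∀ k, tensorAction V W ((Uq.e _ ^ k) ⊗ₜ (Uq.f _ ^ k)) ≠ 0 → IsUnit (twistDen V W x k)
  series : Summable (twistTerm V W x)

/-- `-(q - q^{-1}) x^{-2k} q^{-2k(1+h_2)} e ⊗ f`. -/
def twistProdArg (V : UqRep η ι) (W : UqRep η κ) (x : ℂ) (k : ℕ) : Matrix (ι × κ) (ι × κ) ℂ :=
  (-(Complex.exp η - (Complex.exp η)⁻¹) * (x ^ (2 * k))⁻¹) •
    (qPowH₂ V W (-2 * k) 1 * tensorAction V W (Uq.e _ ⊗ₜ Uq.f _))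

/-- The finite product `∏_{k=0}^{p-1} exp_q(-(q - q^{-1}) x^{-2k} q^{-2k(1+h_2)} e ⊗ f)`, the factor
`k = 0` being the leftmost one. -/
def twistProdPartial (V : UqRep η ι) (W : UqRep η κ) (x : ℂ) : ℕ → Matrix (ι × κ) (ι × κ) ℂ :=
  ascProd fun k => qExp (Complex.exp η) (twistProdArg V W x k)

/-- `Δ(N(x))` on `V ⊗ W`, that is, `N(x)` in the tensor product representation. -/
def NΔ (V : UqRep η ι) (W : UqRep η κ) (x : ℂ) : Matrix (ι × κ) (ι × κ) ℂ :=
  NElt (V.tensor W).toHom (x • 1)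

/-- `N_2(x)` on `V ⊗ W`. -/
def N₂ (V : UqRep η ι) (W : UqRep η κ) (x : ℂ) : Matrix (ι × κ) (ι × κ) ℂ :=
  NElt (act₂ V W) (x • 1)

/-- `N_1(x q^{h_2})` on `V ⊗ W`. -/
def N₁shift (V : UqRep η ι) (W : UqRep η κ) (x : ℂ) : Matrix (ι × κ) (ι × κ) ℂ :=
  NElt (act₁ V W) (x • qPowH₂ V W 1 0)

end Twist

end

open Finset.HasAntidiagonal (antidiagonal)

noncomputable section

/-! Write e, f, k = q^h, l = q^{-h} for the action on the first factor, g = f_2, u =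
x^{-1}q^{-1-h_2}, v = ul and A(g) = -(q-q^{-1}) e g. All arguments of q-exponentials that occur are
rescaled by a power of q^2 (other than 1) under conjugation by some invertible matrix. As q is not a
root of unity, they are nilpotent with exponent the size of the matrix
(`pow_card_eq_zero_of_qcomm`). Hence every q-exponential is a finite sum, and only the infinite
products need analysis. For large |x| both u and v have norm below 1, and the products converge
geometrically.

Coboundary equation. Since Δ(f) = f + l g and v = q^{-1}x^{-1}Δ(q^{-h}), Δ(N_-) is the case P(g) of
the descending product P(g) of the factors exp_{q^{-1}}(v^{2j+1}(f + l g)). Conjugation by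
exp_q(A(g)) exchanges f + l g with f + k g (`semiconj_qExp`) and fixes v. Each new factor splits as
exp(v^{2j+1}f) exp(v^{2j+1}k g), and because v^2 k = l u^2 the k g part of factor j+1 recombines
with the f part of factor j, giving f + l u^2 g (`descProd_mul_qExp`). In the limit P(g) =
exp_q(A(g)) P(u^2 g) exp_{q^{-1}}(u g - A(g)). Iterating in `coboundary`, the left factors build F,
the middle one tends to P(0) = N_{-,1}(x q^{h_2}) by dominated convergence
(`tendsto_descProd_limit`), and the right ones are the factors of N_{-,2}(x) conjugated by N_{+,1}(x
q^{h_2}) (`semiconj_NPlus`). Together with Δ(N_+) = N_{+,1}(x q^{h_2}) N_{+,2}(x) this is Δ(N) = F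
N_1 N_2.

Product formula. With E = x^{-2}q^{-2h_2}, Babelon's series S(A) satisfies S(A) = exp_q(A)
S(q^{-2}EA) (`tsum_twistSeriesTerm_eq`). In each degree this is a q-Vandermonde identity in E. Since
q^{-2}E = u^2, iteration gives the infinite product, the remainder S(u^{2m}A) tending to S(0) = 1.
-/

/-- `q` is nonzero and not a root of unity. -/
structure IsGeneric (q : ℂ) : Prop where
  ne_zero : q ≠ 0
  pow_ne_one : ∀ n : ℕ, 0 < n → q ^ n ≠ 1

/-! ### Arithmetic of `(n)_q` for generic `q`. -/

namespace IsGeneric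
variable {q : ℂ}

theorem inv (h : IsGeneric q) : IsGeneric q⁻¹ :=
  ⟨inv_ne_zero h.ne_zero, fun n hn => by
    rw [inv_pow]; exact fun H => h.pow_ne_one n hn (inv_eq_one.mp H)⟩

theorem pow (h : IsGeneric q) {n : ℕ} (hn : 0 < n) : IsGeneric (q ^ n) :=
  ⟨pow_ne_zero _ h.ne_zero, fun m hm => by
    rw [← pow_mul]; exact h.pow_ne_one _ (Nat.mul_pos hn hm)⟩

theorem sq_sub_one_ne_zero (h : IsGeneric q) : q ^ 2 - 1 ≠ 0 :=
  sub_ne_zero.mpr (h.pow_ne_one 2 two_pos)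

theorem sub_inv_ne_zero (h : IsGeneric q) : q - q⁻¹ ≠ 0 := by
  have h0 := h.ne_zero
  have h1 := h.sq_sub_one_ne_zero
  intro H
  apply h1
  have : q * (q - q⁻¹) = q ^ 2 - 1 := by field_simp
  rw [← this, H, mul_zero]

theorem qParen_eq (h : IsGeneric q) (n : ℕ) :
    qParen q n = ((q ^ 2) ^ n - 1) / (q ^ 2 - 1) := by
  have h0 := h.ne_zero
  have h1 := h.sq_sub_one_ne_zero
  have h2 := h.sub_inv_ne_zero
  rw [qParen, qBracket, zpow_sub_one₀ h0, zpow_natCast]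
  rw [← mul_div_assoc, div_eq_div_iff h2 h1]
  field_simp
  ring

theorem qParen_ne_zero (h : IsGeneric q) (n : ℕ) : qParen q (n + 1) ≠ 0 := by
  rw [h.qParen_eq]
  exact div_ne_zero ((h.pow two_pos |>.pow_ne_one _ n.succ_pos) |> sub_ne_zero.mpr)
    h.sq_sub_one_ne_zero

theorem qParen_zero : qParen q 0 = 0 := by simp [qParen, qBracket]

theorem qParen_one (h : IsGeneric q) : qParen q 1 = 1 := by
  rw [h.qParen_eq, pow_one, div_self h.sq_sub_one_ne_zero]

theorem qParen_add (h : IsGeneric q) (i j : ℕ) :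
    qParen q (i + j) = qParen q i + (q ^ 2) ^ i * qParen q j := by
  have h1 := h.sq_sub_one_ne_zero
  rw [h.qParen_eq, h.qParen_eq, h.qParen_eq]
  field_simp
  ring

theorem pow_eq_qParen (h : IsGeneric q) (n : ℕ) :
    (q ^ 2) ^ n = 1 + (q ^ 2 - 1) * qParen q n := by
  have h1 := h.sq_sub_one_ne_zero
  rw [h.qParen_eq]
  field_simp
  ring

theorem qParen_inv (h : IsGeneric q) (n : ℕ) :
    qParen q (n + 1) = (q ^ 2) ^ n * qParen q⁻¹ (n + 1) := by
  have h0 := h.ne_zero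
  have h1 := h.sq_sub_one_ne_zero
  have h2 := h.inv.sq_sub_one_ne_zero
  have h3 : q⁻¹ ^ 2 - 1 = -(q ^ 2 - 1) / q ^ 2 := by field_simp; ring
  have h4 : (q⁻¹ ^ 2) ^ (n + 1) = ((q ^ 2) ^ (n + 1))⁻¹ := by rw [inv_pow, inv_pow]
  rw [h.qParen_eq, h.inv.qParen_eq, h3, h4]
  field_simp
  ring

theorem qParenFactorial_succ (n : ℕ) :
    qParenFactorial q (n + 1) = qParenFactorial q n * qParen q (n + 1) :=
  Finset.prod_range_succ _ _

theorem qParenFactorial_ne_zero (h : IsGeneric q) (n : ℕ) : qParenFactorial q n ≠ 0 :=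
  Finset.prod_ne_zero_iff.mpr fun i _ => h.qParen_ne_zero i

theorem qParenFactorial_inv (h : IsGeneric q) (n : ℕ) :
    qParenFactorial q n = q ^ (n * (n - 1)) * qParenFactorial q⁻¹ n := by
  induction n with
  | zero => simp [qParenFactorial]
  | succ n ih =>
    rw [qParenFactorial_succ, qParenFactorial_succ, ih, h.qParen_inv]
    have : q ^ ((n + 1) * (n + 1 - 1)) = q ^ (n * (n - 1)) * (q ^ 2) ^ n := by
      rw [← pow_mul, ← pow_add]
      congr 1
      cases n <;> simp; ring
    rw [this]; ring

theorem qParen_mul_inv_factorial (h : IsGeneric q) (n : ℕ) :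
    qParen q (n + 1) * (qParenFactorial q (n + 1))⁻¹ = (qParenFactorial q n)⁻¹ := by
  rw [qParenFactorial_succ, mul_inv, mul_comm, mul_assoc, inv_mul_cancel₀ (h.qParen_ne_zero n),
    mul_one]

end IsGeneric

/-! ### The `q`-exponential of nilpotent matrices -/

section qExp
variable {n : Type*} [Fintype n] [DecidableEq n] {q : ℂ}

theorem qExpTerm_zero (a : Matrix n n ℂ) : qExpTerm q a 0 = 1 := by
  simp [qExpTerm, qParenFactorial]

theorem qExpTerm_succ (h : IsGeneric q) (a : Matrix n n ℂ) (k : ℕ) :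
    qParen q (k + 1) • qExpTerm q a (k + 1) = a * qExpTerm q a k := by
  rw [qExpTerm, smul_smul, h.qParen_mul_inv_factorial, qExpTerm, mul_smul_comm, pow_succ']

theorem qExpTerm_eq_zero {a : Matrix n n ℂ} {N : ℕ} (ha : a ^ N = 0) {k : ℕ} (hk : N ≤ k) :
    qExpTerm q a k = 0 := by
  rw [qExpTerm, pow_eq_zero_of_le hk ha, smul_zero]

theorem hasFiniteSupport_qExpTerm {a : Matrix n n ℂ} (ha : IsNilpotent a) :
    (Function.support (qExpTerm q a)).Finite := by
  obtain ⟨N, hN⟩ := ha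
  refine (Set.finite_lt_nat N).subset fun k hk => ?_
  by_contra hk'
  exact hk (qExpTerm_eq_zero hN (not_lt.mp hk'))

theorem summable_qExpTerm {a : Matrix n n ℂ} (ha : IsNilpotent a) :
    Summable (qExpTerm q a) :=
  summable_of_hasFiniteSupport (hasFiniteSupport_qExpTerm ha)

theorem qExp_eq_sum {a : Matrix n n ℂ} {N : ℕ} (ha : a ^ N = 0) :
    qExp q a = ∑ k ∈ Finset.range N, qExpTerm q a k :=
  tsum_eq_sum fun k hk => qExpTerm_eq_zero ha (by simpa using hk)

theorem qExp_semiconj {p a b : Matrix n n ℂ} (h : SemiconjBy p a b)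
    (ha : IsNilpotent a) (hb : IsNilpotent b) : SemiconjBy p (qExp q a) (qExp q b) := by
  rw [SemiconjBy, qExp, qExp, ← (summable_qExpTerm ha).tsum_mul_left,
    ← (summable_qExpTerm hb).tsum_mul_right]
  congr 1
  ext1 k
  rw [qExpTerm, qExpTerm, mul_smul_comm, smul_mul_assoc, (h.pow_right k).eq]

open scoped Matrix.Norms.Operator in
theorem qExp_mul_qExp {q' : ℂ} {a b : Matrix n n ℂ} (ha : IsNilpotent a) (hb : IsNilpotent b) :
    qExp q a * qExp q' b = ∑' k, ∑ ij ∈ antidiagonal k, qExpTerm q a ij.1 * qExpTerm q' b ij.2 := by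
  refine tsum_mul_tsum_eq_tsum_sum_antidiagonal_of_summable_norm ?_ ?_
  · refine summable_of_hasFiniteSupport ((hasFiniteSupport_qExpTerm (q := q) ha).subset ?_)
    intro k hk; simpa using hk
  · refine summable_of_hasFiniteSupport ((hasFiniteSupport_qExpTerm (q := q') hb).subset ?_)
    intro k hk; simpa using hk

theorem mul_pow_of_qcomm {t : ℂ} {a b : Matrix n n ℂ} (hab : b * a = t • (a * b)) (i : ℕ) :
    b * a ^ i = t ^ i • (a ^ i * b) := by
  induction i with
  | zero => simp
  | succ i ih =>
    rw [pow_succ, ← mul_assoc, ih, smul_mul_assoc, mul_assoc, hab, mul_smul_comm, smul_smul,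
      pow_succ t, mul_assoc]

/-- The `q`-binomial theorem, for divided powers. -/
theorem sum_antidiagonal_qExpTerm (hq : IsGeneric q) {a b : Matrix n n ℂ}
    (hab : b * a = q ^ 2 • (a * b)) (k : ℕ) :
    ∑ ij ∈ antidiagonal k, qExpTerm q a ij.1 * qExpTerm q b ij.2 = qExpTerm q (a + b) k := by
  induction k with
  | zero => simp [qExpTerm_zero]
  | succ k ih =>
    have hne := hq.qParen_ne_zero k
    refine smul_right_injective _ hne ?_
    simp only
    rw [qExpTerm_succ hq, ← ih, Finset.smul_sum]
    -- The q-Pascal rule (i+j)_q = (i)_q + q^{2i}(j)_q. The first summand lowers the power of a; the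
    -- second lowers that of b, and q^{2i} is exactly the cost of moving the freed b to the left
    -- past a^i.
    have h1 : ∀ ij ∈ antidiagonal (k + 1),
        qParen q (k + 1) • (qExpTerm q a ij.1 * qExpTerm q b ij.2) =
          (qParen q ij.1 • qExpTerm q a ij.1) * qExpTerm q b ij.2 +
          ((q ^ 2) ^ ij.1 • qExpTerm q a ij.1) * (qParen q ij.2 • qExpTerm q b ij.2) := by
      intro ij hij
      rw [← Finset.HasAntidiagonal.mem_antidiagonal.mp hij, hq.qParen_add, add_smul, smul_mul_assoc,
        smul_mul_smul_comm]
    rw [Finset.sum_congr rfl h1, Finset.sum_add_distrib, Finset.Nat.sum_antidiagonal_succ,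
      Finset.Nat.sum_antidiagonal_succ' (n := k) (f := fun ij : ℕ × ℕ =>
        ((q ^ 2) ^ ij.1 • qExpTerm q a ij.1) * (qParen q ij.2 • qExpTerm q b ij.2)),
      add_mul, Finset.mul_sum, Finset.mul_sum]
    simp only [IsGeneric.qParen_zero, zero_smul, zero_mul, mul_zero, zero_add]
    congr 1
    · refine Finset.sum_congr rfl fun ij _ => ?_
      rw [qExpTerm_succ hq, mul_assoc]
    · refine Finset.sum_congr rfl fun ij _ => ?_
      rw [qExpTerm_succ hq, ← mul_assoc, ← mul_assoc]
      congr 1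
      rw [qExpTerm, mul_smul_comm, mul_pow_of_qcomm hab, smul_mul_assoc, smul_mul_assoc,
        smul_comm]

theorem qExp_add (hq : IsGeneric q) {a b : Matrix n n ℂ} (hab : b * a = q ^ 2 • (a * b))
    (ha : IsNilpotent a) (hb : IsNilpotent b) : qExp q (a + b) = qExp q a * qExp q b := by
  rw [qExp_mul_qExp ha hb, qExp]
  exact tsum_congr fun k => (sum_antidiagonal_qExpTerm hq hab k).symm

/-- After multiplication by (k+1)_q = (j)_q + q^{2j}(i)_q the sum breaks into two halves. Passing
from (j+1)_q to (j+1)_{q^{-1}} costs q^{2j}, so the halves agree up to the sign of -a and cancel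
term by term. -/
theorem sum_antidiagonal_qExpTerm_inv (hq : IsGeneric q) (a : Matrix n n ℂ) (k : ℕ) :
    ∑ ij ∈ antidiagonal (k + 1), qExpTerm q a ij.1 * qExpTerm q⁻¹ (-a) ij.2 = 0 := by
  have hne := hq.qParen_ne_zero k
  refine smul_right_injective _ hne ?_
  simp only [smul_zero]
  rw [Finset.smul_sum]
  have h1 : ∀ ij ∈ antidiagonal (k + 1),
      qParen q (k + 1) • (qExpTerm q a ij.1 * qExpTerm q⁻¹ (-a) ij.2) =
        (qParen q ij.2 • qExpTerm q⁻¹ (-a) ij.2) * qExpTerm q a ij.1 +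
        ((q ^ 2) ^ ij.2 • qExpTerm q⁻¹ (-a) ij.2) * (qParen q ij.1 • qExpTerm q a ij.1) := by
    intro ij hij
    have hc : Commute (qExpTerm q a ij.1) (qExpTerm q⁻¹ (-a) ij.2) := by
      unfold qExpTerm
      exact (((Commute.refl a).neg_right.pow_pow _ _).smul_left _).smul_right _
    rw [hc.eq, ← Finset.HasAntidiagonal.mem_antidiagonal.mp hij, add_comm, hq.qParen_add, add_smul,
      smul_mul_assoc, smul_mul_smul_comm]
  rw [Finset.sum_congr rfl h1, Finset.sum_add_distrib, Finset.Nat.sum_antidiagonal_succ',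
    Finset.Nat.sum_antidiagonal_succ (n := k) (f := fun ij : ℕ × ℕ =>
        ((q ^ 2) ^ ij.2 • qExpTerm q⁻¹ (-a) ij.2) * (qParen q ij.1 • qExpTerm q a ij.1))]
  simp only [IsGeneric.qParen_zero, zero_smul, zero_mul, mul_zero, zero_add]
  rw [← Finset.sum_add_distrib]
  refine Finset.sum_eq_zero fun ij _ => ?_
  have hc : Commute a (qExpTerm q⁻¹ (-a) ij.2) :=
    ((Commute.refl a).neg_right.pow_right _).smul_right _
  rw [qExpTerm_succ hq, hq.qParen_inv, mul_smul, qExpTerm_succ hq.inv, neg_mul, smul_neg,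
    ← mul_assoc, smul_mul_assoc, neg_mul, smul_mul_assoc, smul_mul_assoc, hc.eq,
    neg_add_cancel]

theorem qExp_mul_qExp_inv (hq : IsGeneric q) {a : Matrix n n ℂ} (ha : IsNilpotent a) :
    qExp q a * qExp q⁻¹ (-a) = 1 := by
  rw [qExp_mul_qExp ha ha.neg, tsum_eq_single 0]
  · simp [qExpTerm_zero]
  · intro k hk
    obtain ⟨k, rfl⟩ := Nat.exists_eq_succ_of_ne_zero hk
    exact sum_antidiagonal_qExpTerm_inv hq a k

/-- The q-difference equation of the exponential: q^{2k} = 1 + (q^2-1)(k)_q, and (k)_q turns the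
k-th term into a times the preceding one. -/
theorem qExp_sq_smul (hq : IsGeneric q) {a : Matrix n n ℂ} (ha : IsNilpotent a) :
    qExp q (q ^ 2 • a) = (1 + (q ^ 2 - 1) • a) * qExp q a := by
  have hs := summable_qExpTerm (q := q) ha
  have hs' := summable_qExpTerm (q := q) (ha.smul (q ^ 2))
  have h1 : ∀ k, qExpTerm q (q ^ 2 • a) (k + 1) =
      qExpTerm q a (k + 1) + (q ^ 2 - 1) • a * qExpTerm q a k := by
    intro k
    have h2 : qExpTerm q (q ^ 2 • a) (k + 1) = (q ^ 2) ^ (k + 1) • qExpTerm q a (k + 1) := by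
      rw [qExpTerm, qExpTerm, smul_pow, smul_comm]
    rw [smul_mul_assoc, ← qExpTerm_succ hq, smul_smul, h2, hq.pow_eq_qParen, add_smul, one_smul]
  rw [add_mul, one_mul, qExp, hs'.tsum_eq_zero_add, qExp, ← hs.tsum_mul_left]
  conv_rhs => rw [hs.tsum_eq_zero_add]
  rw [tsum_congr h1, ((summable_nat_add_iff 1).mpr hs).tsum_add (hs.mul_left _), qExpTerm_zero,
    qExpTerm_zero, add_assoc]

end qExp

/-! ### Nilpotency -/

section Nilpotent
variable {n : Type*} [Fintype n] [DecidableEq n]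

/-- Conjugation by p multiplies a by t, so the spectrum of a is stable under t. A nonzero eigenvalue
would have an infinite orbit, so the characteristic polynomial is a power of X and Cayley-Hamilton
applies. The exponent depends only on the size, which makes later estimates uniform over families of
matrices. -/
theorem pow_card_eq_zero_of_qcomm {t : ℂ} (ht : IsGeneric t) {p a : Matrix n n ℂ} (hp : IsUnit p)
    (h : p * a = t • (a * p)) : a ^ Fintype.card n = 0 := by
  have hroots : ∀ z ∈ a.charpoly.roots, z = 0 := by
    intro z hz
    by_contra hz0
    obtain ⟨p, rfl⟩ := hp
    have hconj : (p : Matrix n n ℂ) * a * (p⁻¹ : (Matrix n n ℂ)ˣ) = t • a := by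
      rw [h, smul_mul_assoc, mul_assoc, Units.mul_inv, mul_one]
    have hstep : ∀ w ∈ spectrum ℂ a, t * w ∈ spectrum ℂ a := by
      intro w hw
      rw [← spectrum.units_conjugate (R := ℂ) (u := p), hconj]
      have := spectrum.unit_smul_eq_smul a (Units.mk0 t ht.ne_zero)
      rw [Units.smul_def, Units.val_mk0] at this
      rw [this]
      exact Set.smul_mem_smul_set hw
    have hmem : ∀ k : ℕ, t ^ k * z ∈ spectrum ℂ a := by
      intro k
      induction k with
      | zero =>
        rw [pow_zero, one_mul, Matrix.mem_spectrum_iff_isRoot_charpoly]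
        exact Polynomial.isRoot_of_mem_roots hz
      | succ k ih => rw [pow_succ', mul_assoc]; exact hstep _ ih
    have hinj : Function.Injective fun k : ℕ => t ^ k * z := by
      intro i j hij
      have hij' : t ^ i = t ^ j := mul_right_cancel₀ hz0 hij
      by_contra hne
      wlog hlt : i < j generalizing i j
      · exact this hij.symm hij'.symm (Ne.symm hne) (by omega)
      refine ht.pow_ne_one (j - i) (by omega) ?_
      rw [pow_sub₀ _ ht.ne_zero hlt.le, hij', mul_inv_cancel₀ (pow_ne_zero _ ht.ne_zero)]
    exact Set.infinite_of_injective_forall_mem hinj hmem (Matrix.finite_spectrum a)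
  have hch : a.charpoly = Polynomial.X ^ Fintype.card n := by
    rw [(IsAlgClosed.splits a.charpoly).eq_prod_roots_of_monic a.charpoly_monic,
      Multiset.eq_replicate_of_mem hroots]
    simp [← (IsAlgClosed.splits a.charpoly).natDegree_eq_card_roots]
  have := a.aeval_self_charpoly
  rwa [hch, map_pow, Polynomial.aeval_X] at this

end Nilpotent

/-! ### Ordered infinite products -/

section OrderedProduct

theorem descProd_mul_ascProd_eq_one {R : Type*} [Monoid R] {A B : ℕ → R}
    (h : ∀ k, A k * B k = 1) (m : ℕ) : descProd A m * ascProd B m = 1 := by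
  induction m with
  | zero => exact one_mul 1
  | succ m ih =>
    rw [descProd, ascProd, mul_assoc, ← mul_assoc (descProd A m), ih, one_mul, h]

theorem descProd_semiconj {R : Type*} [Monoid R] {p : R} {A B : ℕ → R}
    (h : ∀ k, SemiconjBy p (A k) (B k)) (m : ℕ) :
    SemiconjBy p (descProd A m) (descProd B m) := by
  induction m with
  | zero => exact SemiconjBy.one_right p
  | succ m ih => exact (h m).mul_right ih

/-- Rebracketing: B of each step is paired with A of the step to its right, leaving the top A and
the bottom B unpaired. -/
theorem descProd_mul_shift {R : Type*} [Monoid R] (A B : ℕ → R) (m : ℕ) :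
    descProd (fun k => A k * B k) (m + 1) =
      A m * descProd (fun k => B (k + 1) * A k) m * B 0 := by
  induction m with
  | zero => simp [descProd]
  | succ m ih =>
    rw [descProd, ih, descProd]
    simp only [mul_assoc]

variable {R : Type*} [NormedRing R]

/-- Telescoping turns an ordered product into a series, so that absolute convergence and dominated
convergence for series become available without commutativity. -/
theorem descProd_eq_one_add_sum (A : ℕ → R) (m : ℕ) :
    descProd A m = 1 + ∑ k ∈ Finset.range m, (A k - 1) * descProd A k := by
  induction m with
  | zero => simp [descProd]
  | succ m ih => rw [Finset.sum_range_succ, ← add_assoc, ← ih, descProd]; noncomm_ring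

theorem ascProd_eq_one_add_sum (A : ℕ → R) (m : ℕ) :
    ascProd A m = 1 + ∑ k ∈ Finset.range m, ascProd A k * (A k - 1) := by
  induction m with
  | zero => simp [ascProd]
  | succ m ih => rw [Finset.sum_range_succ, ← add_assoc, ← ih, ascProd]; noncomm_ring

theorem prod_one_add_le_exp_tsum {β : ℕ → ℝ} (hβ : Summable β) (h0 : ∀ k, 0 ≤ β k) (m : ℕ) :
    ∏ k ∈ Finset.range m, (1 + β k) ≤ Real.exp (∑' k, β k) := by
  calc ∏ k ∈ Finset.range m, (1 + β k)
      ≤ ∏ k ∈ Finset.range m, Real.exp (β k) :=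
        Finset.prod_le_prod (fun k _ => by linarith [h0 k])
          fun k _ => by linarith [Real.add_one_le_exp (β k)]
    _ = Real.exp (∑ k ∈ Finset.range m, β k) := (Real.exp_sum _ _).symm
    _ ≤ _ := Real.exp_le_exp.mpr (hβ.sum_le_tsum _ fun k _ => h0 k)

variable {A : ℕ → R} {β : ℕ → ℝ}

/-- The factor ‖1‖ is kept because the norm of the identity need not be 1: it is 0 for matrices over
an empty index type. -/
theorem norm_descProd_le (hβ : Summable β) (hA : ∀ k, ‖A k - 1‖ ≤ β k) (m : ℕ) :
    ‖descProd A m‖ ≤ ‖(1 : R)‖ * Real.exp (∑' k, β k) := by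
  have h0 : ∀ k, 0 ≤ β k := fun k => (norm_nonneg _).trans (hA k)
  refine le_trans ?_ (mul_le_mul_of_nonneg_left (prod_one_add_le_exp_tsum hβ h0 m) (norm_nonneg _))
  induction m with
  | zero => simp [descProd]
  | succ m ih =>
    rw [descProd, Finset.prod_range_succ, ← mul_assoc, mul_comm _ (1 + β m)]
    calc ‖A m * descProd A m‖ = ‖descProd A m + (A m - 1) * descProd A m‖ := by
          congr 1; noncomm_ring
      _ ≤ ‖descProd A m‖ + ‖A m - 1‖ * ‖descProd A m‖ :=
          (norm_add_le _ _).trans (by gcongr; exact norm_mul_le _ _)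
      _ ≤ ‖descProd A m‖ + β m * ‖descProd A m‖ := by gcongr; exact hA m
      _ = (1 + β m) * ‖descProd A m‖ := by ring
      _ ≤ _ := mul_le_mul_of_nonneg_left ih (by linarith [h0 m])

theorem norm_ascProd_le (hβ : Summable β) (hA : ∀ k, ‖A k - 1‖ ≤ β k) (m : ℕ) :
    ‖ascProd A m‖ ≤ ‖(1 : R)‖ * Real.exp (∑' k, β k) := by
  have h0 : ∀ k, 0 ≤ β k := fun k => (norm_nonneg _).trans (hA k)
  refine le_trans ?_ (mul_le_mul_of_nonneg_left (prod_one_add_le_exp_tsum hβ h0 m) (norm_nonneg _))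
  induction m with
  | zero => simp [ascProd]
  | succ m ih =>
    rw [ascProd, Finset.prod_range_succ, ← mul_assoc, mul_comm _ (1 + β m)]
    calc ‖ascProd A m * A m‖ = ‖ascProd A m + ascProd A m * (A m - 1)‖ := by
          congr 1; noncomm_ring
      _ ≤ ‖ascProd A m‖ + ‖ascProd A m‖ * ‖A m - 1‖ :=
          (norm_add_le _ _).trans (by gcongr; exact norm_mul_le _ _)
      _ ≤ ‖ascProd A m‖ + ‖ascProd A m‖ * β m := by gcongr; exact hA m
      _ = (1 + β m) * ‖ascProd A m‖ := by ring
      _ ≤ _ := mul_le_mul_of_nonneg_left ih (by linarith [h0 m])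

theorem norm_descProd_term_le (hβ : Summable β) (hA : ∀ k, ‖A k - 1‖ ≤ β k) (m : ℕ) :
    ‖(A m - 1) * descProd A m‖ ≤ β m * (‖(1 : R)‖ * Real.exp (∑' k, β k)) :=
  (norm_mul_le _ _).trans (mul_le_mul (hA m) (norm_descProd_le hβ hA m) (norm_nonneg _)
    ((norm_nonneg _).trans (hA m)))

variable [CompleteSpace R]

theorem tendsto_descProd (hβ : Summable β) (hA : ∀ k, ‖A k - 1‖ ≤ β k) :
    Tendsto (descProd A) atTop (𝓝 (1 + ∑' k, (A k - 1) * descProd A k)) := by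
  refine Tendsto.congr (fun m => (descProd_eq_one_add_sum A m).symm) ?_
  exact (Summable.of_norm_bounded (hβ.mul_right _)
    (norm_descProd_term_le hβ hA)).hasSum.tendsto_sum_nat.const_add 1

theorem exists_tendsto_ascProd (hβ : Summable β) (hA : ∀ k, ‖A k - 1‖ ≤ β k) :
    ∃ L, Tendsto (ascProd A) atTop (𝓝 L) := by
  have hs : Summable fun k => ascProd A k * (A k - 1) :=
    Summable.of_norm_bounded (hβ.mul_left (‖(1 : R)‖ * Real.exp (∑' k, β k))) fun k =>
      (norm_mul_le _ _).trans (mul_le_mul (norm_ascProd_le hβ hA k) (hA k) (norm_nonneg _)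
        ((norm_nonneg _).trans (norm_ascProd_le hβ hA k)))
  exact ⟨_, Tendsto.congr (fun m => (ascProd_eq_one_add_sum A m).symm)
    (hs.hasSum.tendsto_sum_nat.const_add 1)⟩

/-- Dominated convergence for ordered infinite products. -/
theorem tendsto_descProd_limit {B : ℕ → ℕ → R} (hβ : Summable β) (hA : ∀ k, ‖A k - 1‖ ≤ β k)
    (hB : ∀ i k, ‖B i k - 1‖ ≤ β k) (hBA : ∀ k, Tendsto (fun i => B i k) atTop (𝓝 (A k)))
    {L : ℕ → R} (hL : ∀ i, Tendsto (descProd (B i)) atTop (𝓝 (L i)))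
    {L' : R} (hL' : Tendsto (descProd A) atTop (𝓝 L')) : Tendsto L atTop (𝓝 L') := by
  rw [tendsto_nhds_unique hL' (tendsto_descProd hβ hA),
    funext fun i => tendsto_nhds_unique (hL i) (tendsto_descProd hβ (hB i))]
  have hD : ∀ k, Tendsto (fun i => descProd (B i) k) atTop (𝓝 (descProd A k)) := by
    intro k
    induction k with
    | zero => exact tendsto_const_nhds
    | succ k ih => exact (hBA k).mul ih
  refine (tendsto_tsum_of_dominated_convergence
    (bound := fun k => β k * (‖(1 : R)‖ * Real.exp (∑' k, β k))) (hβ.mul_right _)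
    (fun k => ((hBA k).sub_const 1).mul (hD k))
    (Eventually.of_forall fun i k => norm_descProd_term_le hβ (hB i) k)).const_add 1

end OrderedProduct

/-! ### Estimates for the `q`-exponential -/

section Estimate
open scoped Matrix.Norms.Operator
variable {n : Type*} [Fintype n] [DecidableEq n]

/-- A constant such that `‖exp_q(a) - 1‖ ≤ C ρ` for `a ^ N = 0`, `‖a‖ ≤ M ρ`, `ρ ≤ 1`. -/
def qExpBound (q : ℂ) (N : ℕ) (M : ℝ) : ℝ :=
  ∑ k ∈ Finset.range N, ‖(qParenFactorial q (k + 1))⁻¹‖ * M ^ (k + 1)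

theorem norm_qExp_sub_one_le {q : ℂ} {N : ℕ} {M ρ : ℝ} {a : Matrix n n ℂ} (ha : a ^ N = 0)
    (hM : 0 ≤ M) (hρ : 0 ≤ ρ) (hρ1 : ρ ≤ 1) (h : ‖a‖ ≤ M * ρ) :
    ‖qExp q a - 1‖ ≤ qExpBound q N M * ρ := by
  -- One extra power guarantees that the constant term lies in the range and can be split off, even
  -- for N = 0.
  have ha' : a ^ (N + 1) = 0 := by rw [pow_succ, ha, zero_mul]
  rw [qExp_eq_sum ha', Finset.sum_range_succ', qExpTerm_zero, add_sub_cancel_right, qExpBound,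
    Finset.sum_mul]
  refine (norm_sum_le _ _).trans (Finset.sum_le_sum fun k _ => ?_)
  rw [qExpTerm, norm_smul, mul_assoc]
  refine mul_le_mul_of_nonneg_left ?_ (norm_nonneg _)
  calc ‖a ^ (k + 1)‖ ≤ ‖a‖ ^ (k + 1) := norm_pow_le' _ k.succ_pos
    _ ≤ (M * ρ) ^ (k + 1) := pow_le_pow_left₀ (norm_nonneg _) h _
    _ = M ^ (k + 1) * ρ ^ (k + 1) := mul_pow _ _ _
    _ ≤ M ^ (k + 1) * ρ := by
      refine mul_le_mul_of_nonneg_left ?_ (pow_nonneg hM _)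
      exact pow_le_of_le_one hρ hρ1 k.succ_ne_zero

theorem tendsto_qExp {q : ℂ} {N : ℕ} {a : ℕ → Matrix n n ℂ} {b : Matrix n n ℂ}
    (ha : ∀ i, a i ^ N = 0) (hb : b ^ N = 0) (h : Tendsto a atTop (𝓝 b)) :
    Tendsto (fun i => qExp q (a i)) atTop (𝓝 (qExp q b)) := by
  rw [qExp_eq_sum hb, funext fun i => qExp_eq_sum (ha i)]
  exact tendsto_finsetSum _ fun k _ => (h.pow k).const_smul _

end Estimate

/-! ### `q`-commuting elements -/

/-- `p a = t a p`. -/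
def QComm {R : Type*} [Ring R] [Algebra ℂ R] (t : ℂ) (p a : R) : Prop := p * a = t • (a * p)

namespace QComm
section
variable {R : Type*} [Ring R] [Algebra ℂ R] {t s : ℂ} {p p' a b : R}

theorem of_commute (h : Commute p a) : QComm 1 p a := by rw [QComm, one_smul, h.eq]

theorem commute (h : QComm 1 p a) : Commute p a := by rw [QComm, one_smul] at h; exact h

theorem of_eq (h : QComm t p a) (hts : t = s) : QComm s p a := hts ▸ h

theorem symm (h : QComm t p a) (ht : t ≠ 0) : QComm t⁻¹ a p := by
  rw [QComm] at *; rw [h, smul_smul, inv_mul_cancel₀ ht, one_smul]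

theorem mul_right (h : QComm t p a) (h' : QComm s p b) : QComm (t * s) p (a * b) := by
  rw [QComm] at *
  rw [← mul_assoc, h, smul_mul_assoc, mul_assoc, h', mul_smul_comm, smul_smul, mul_assoc]

theorem mul_left (h : QComm t p a) (h' : QComm s p' a) : QComm (t * s) (p * p') a := by
  rw [QComm] at *
  rw [mul_assoc, h', mul_smul_comm, ← mul_assoc, h, smul_mul_assoc, smul_smul, mul_assoc,
    mul_comm]

theorem pow_right (h : QComm t p a) (n : ℕ) : QComm (t ^ n) p (a ^ n) := by
  induction n with
  | zero => simp [QComm]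
  | succ n ih => rw [pow_succ, pow_succ]; exact ih.mul_right h

theorem pow_left (h : QComm t p a) (n : ℕ) : QComm (t ^ n) (p ^ n) a := by
  induction n with
  | zero => simp [QComm]
  | succ n ih => rw [pow_succ, pow_succ]; exact ih.mul_left h

theorem add_right (h : QComm t p a) (h' : QComm t p b) : QComm t p (a + b) := by
  rw [QComm] at *; rw [mul_add, add_mul, smul_add, h, h']

theorem smul_right (h : QComm t p a) (c : ℂ) : QComm t p (c • a) := by
  rw [QComm] at *; rw [mul_smul_comm, smul_mul_assoc, h, smul_comm]

theorem smul_left (h : QComm t p a) (c : ℂ) : QComm t (c • p) a := by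
  rw [QComm] at *; rw [mul_smul_comm, smul_mul_assoc, h, smul_comm]

theorem self_pow_mul (m : ℕ) (h : QComm t p a) : QComm t p (p ^ m * a) :=
  ((of_commute ((Commute.refl p).pow_right m)).mul_right h).of_eq (one_mul _)

end

theorem pow_card_eq_zero {n : Type*} [Fintype n] [DecidableEq n] {t : ℂ} {p a : Matrix n n ℂ}
    (h : QComm t p a) (hp : IsUnit p) (ht : IsGeneric t) : a ^ Fintype.card n = 0 :=
  pow_card_eq_zero_of_qcomm ht hp h

theorem isNilpotent {n : Type*} [Fintype n] [DecidableEq n] {t : ℂ} {p a : Matrix n n ℂ}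
    (h : QComm t p a) (hp : IsUnit p) (ht : IsGeneric t) : IsNilpotent a :=
  ⟨_, h.pow_card_eq_zero hp ht⟩

end QComm

/-! ### Convergence of ordered products of `q`-exponentials -/

section Convergence
open scoped Matrix.Norms.Operator
variable {n : Type*} [Fintype n] [DecidableEq n] {q : ℂ}

/-- Keeping the factor y makes k = 0 trivial, with no assumption on ‖1‖. -/
theorem norm_pow_mul_le {R : Type*} [NormedRing R] (v y : R) (k : ℕ) :
    ‖v ^ k * y‖ ≤ ‖v‖ ^ k * ‖y‖ := by
  induction k with
  | zero => simp
  | succ k ih =>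
    rw [pow_succ', pow_succ', mul_assoc, mul_assoc]
    exact (norm_mul_le _ _).trans (mul_le_mul_of_nonneg_left ih (norm_nonneg _))

theorem norm_qExp_pow_mul_sub_one_le {N : ℕ} {M : ℝ} {v y : Matrix n n ℂ} (hv : ‖v‖ < 1)
    (hy : ‖y‖ ≤ M) {k : ℕ} (h : (v ^ (2 * k + 1) * y) ^ N = 0) :
    ‖qExp q (v ^ (2 * k + 1) * y) - 1‖ ≤ qExpBound q N M * ‖v‖ ^ k := by
  have hM := (norm_nonneg y).trans hy
  refine norm_qExp_sub_one_le h hM (by positivity) (pow_le_one₀ (norm_nonneg _) hv.le) ?_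
  calc ‖v ^ (2 * k + 1) * y‖ ≤ ‖v‖ ^ (2 * k + 1) * ‖y‖ := norm_pow_mul_le _ _ _
    _ ≤ ‖v‖ ^ k * M := mul_le_mul
        (pow_le_pow_of_le_one (norm_nonneg _) hv.le (by omega)) hy (norm_nonneg _) (by positivity)
    _ = M * ‖v‖ ^ k := mul_comm _ _

theorem summable_qExpBound (N : ℕ) (M : ℝ) {v : Matrix n n ℂ} (hv : ‖v‖ < 1) :
    Summable fun k : ℕ => qExpBound q N M * ‖v‖ ^ k :=
  (summable_geometric_of_lt_one (norm_nonneg _) hv).mul_left _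

/-- The inverse comes from the product in the opposite order of the factors exp_{q^{-1}}(-a): it
converges for the same reason, and the partial products multiply to 1. A right inverse suffices for
square matrices. -/
theorem exists_tendsto_descProd_qExp (hq : IsGeneric q) {N : ℕ} {v y : Matrix n n ℂ}
    (hv : ‖v‖ < 1) (h : ∀ k : ℕ, (v ^ (2 * k + 1) * y) ^ N = 0) :
    ∃ L, IsUnit L ∧ Tendsto (descProd fun k => qExp q (v ^ (2 * k + 1) * y)) atTop (𝓝 L) := by
  have h1 := tendsto_descProd (summable_qExpBound (q := q) N _ hv)
    fun k => norm_qExp_pow_mul_sub_one_le hv le_rfl (h k)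
  have h' : ∀ k : ℕ, (v ^ (2 * k + 1) * -y) ^ N = 0 := fun k => by
    rw [mul_neg, neg_pow, h k, mul_zero]
  obtain ⟨L', h2⟩ := exists_tendsto_ascProd (summable_qExpBound (q := q⁻¹) N _ hv)
    fun k => norm_qExp_pow_mul_sub_one_le hv le_rfl (h' k)
  refine ⟨_, ?_, h1⟩
  have h3 := tendsto_nhds_unique (h1.mul h2) <| tendsto_const_nhds.congr fun m =>
    (descProd_mul_ascProd_eq_one (fun k => by
      rw [mul_neg]; exact qExp_mul_qExp_inv hq ⟨N, h k⟩) m).symm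
  rw [Matrix.isUnit_iff_isUnit_det]
  exact Matrix.isUnit_det_of_right_inverse h3

end Convergence

/-! ### The exchange relations behind the coboundary equation -/

/-- The relations satisfied by `e = e_1`, `f = f_1`, `k = q^{h_1}`, `l = q^{-h_1}`,
`g = q^{-m h_2} f_2` and `u = x^{-1} q^{-1-h_2}`. -/
structure DynRel {R : Type*} [Ring R] [Algebra ℂ R] (q : ℂ) (e f k l g u : R) : Prop where
  kl : k * l = 1
  lk : l * k = 1
  ke : QComm (q ^ 2) k e
  kf : QComm (q ^ 2)⁻¹ k f
  ef : e * f - f * e = (q - q⁻¹)⁻¹ • (k - l)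
  ge : Commute g e
  gf : Commute g f
  gk : Commute g k
  ue : Commute u e
  uf : Commute u f
  uk : Commute u k
  ug : QComm (q ^ 2) u g
  isUnit : IsUnit u

namespace DynRel
-- Weights and commutators derived from the exchange relations.
section
variable {R : Type*} [Ring R] [Algebra ℂ R] {q : ℂ} {e f k l g u : R}

theorem commute_l (h : DynRel q e f k l g u) {a : R} (ha : Commute a k) : Commute a l := by
  calc a * l = l * (k * a) * l := by rw [← mul_assoc, h.lk, one_mul]
    _ = l * a * (k * l) := by rw [← ha.eq]; simp only [mul_assoc]
    _ = l * a := by rw [h.kl, mul_one]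

theorem qcomm_l (h : DynRel q e f k l g u) {a : R} {t : ℂ} (ht : t ≠ 0) (ha : QComm t k a) :
    QComm t⁻¹ l a := by
  rw [QComm] at *
  calc l * a = l * a * (k * l) := by rw [h.kl, mul_one]
    _ = t⁻¹ • (l * (t • (a * k)) * l) := by
      rw [mul_smul_comm, smul_mul_assoc, smul_smul, inv_mul_cancel₀ ht, one_smul]
      simp only [mul_assoc]
    _ = t⁻¹ • (a * l) := by rw [← ha, ← mul_assoc, h.lk, one_mul]

/-- This is what allows the basic exchange step to be iterated with g replaced by u^{2i}g: u
commutes with e, f, k and itself, so no weight changes. -/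
theorem pow_mul (h : DynRel q e f k l g u) (n : ℕ) : DynRel q e f k l (u ^ n * g) u :=
  { h with
    ge := (h.ue.pow_left n).mul_left h.ge
    gf := (h.uf.pow_left n).mul_left h.gf
    gk := (h.uk.pow_left n).mul_left h.gk
    ug := ((QComm.of_commute ((Commute.refl u).pow_right n)).mul_right h.ug).of_eq (one_mul _) }

variable (h : DynRel q e f k l g u) (hq : IsGeneric q)
include h

theorem gl : Commute g l := h.commute_l h.gk

theorem ul : Commute u l := h.commute_l h.uk

theorem isUnit_v : IsUnit (u * l) := h.isUnit.mul ⟨⟨l, k, h.lk, h.kl⟩, rfl⟩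

include hq

theorem le : QComm (q ^ 2)⁻¹ l e := h.qcomm_l (pow_ne_zero 2 hq.ne_zero) h.ke

theorem lf : QComm (q ^ 2) l f :=
  (h.qcomm_l (inv_ne_zero (pow_ne_zero 2 hq.ne_zero)) h.kf).of_eq (inv_inv _)

theorem ve : QComm (q ^ 2)⁻¹ (u * l) e :=
  ((QComm.of_commute h.ue).mul_left (h.le hq)).of_eq (one_mul _)

theorem vf : QComm (q ^ 2) (u * l) f :=
  ((QComm.of_commute h.uf).mul_left (h.lf hq)).of_eq (one_mul _)

omit hq in
theorem vg : QComm (q ^ 2) (u * l) g :=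
  (h.ug.mul_left (QComm.of_commute h.gl.symm)).of_eq (mul_one _)

omit hq in
theorem vk : Commute (u * l) k :=
  h.uk.mul_left (show Commute l k from h.lk.trans h.kl.symm)

omit hq in
theorem vl : Commute (u * l) l := h.ul.mul_left (Commute.refl l)

theorem qcomm_v_add (m : ℕ) : QComm (q ^ 2) (u * l) ((u * l) ^ m * (f + l * g)) :=
  QComm.self_pow_mul m <| (h.vf hq).add_right <|
    ((QComm.of_commute h.vl).mul_right h.vg).of_eq (one_mul _)

omit hq in
theorem qcomm_u_eg : QComm (q ^ 2) u (e * g) :=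
  ((QComm.of_commute h.ue).mul_right h.ug).of_eq (one_mul _)

theorem qcomm_vf_vlg (m : ℕ) :
    QComm (q ^ 2)⁻¹ ((u * l) ^ m * f) ((u * l) ^ m * (l * g)) := by
  have h2 := pow_ne_zero 2 hq.ne_zero
  have h3 : QComm ((q ^ 2) ^ m) ((u * l) ^ m) ((u * l) ^ m * (l * g)) :=
    (QComm.self_pow_mul m
      (((QComm.of_commute h.vl).mul_right h.vg).of_eq (one_mul _))).pow_left m
  have h4 : QComm (((q ^ 2)⁻¹) ^ m * ((q ^ 2)⁻¹ * 1)) f ((u * l) ^ m * (l * g)) :=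
    (((h.vf hq).symm h2).pow_right m).mul_right
      (((h.lf hq).symm h2).mul_right (QComm.of_commute h.gf.symm))
  refine (h3.mul_left h4).of_eq ?_
  rw [mul_one, inv_pow, ← mul_assoc, mul_inv_cancel₀ (pow_ne_zero m h2), one_mul]

theorem qcomm_vkg_vf (m : ℕ) :
    QComm (q ^ 2)⁻¹ ((u * l) ^ m * (k * g)) ((u * l) ^ m * f) := by
  have h2 := pow_ne_zero 2 hq.ne_zero
  have h3 : QComm ((q ^ 2) ^ m) ((u * l) ^ m) ((u * l) ^ m * f) :=
    (QComm.self_pow_mul m (h.vf hq)).pow_left m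
  have h4 : QComm (1 ^ m * (q ^ 2)⁻¹) k ((u * l) ^ m * f) :=
    ((QComm.of_commute h.vk.symm).pow_right m).mul_right h.kf
  have h5 : QComm ((q ^ 2)⁻¹ ^ m * 1) g ((u * l) ^ m * f) :=
    ((h.vg.symm h2).pow_right m).mul_right (QComm.of_commute h.gf)
  refine (h3.mul_left (h4.mul_left h5)).of_eq ?_
  rw [mul_one, one_pow, one_mul, inv_pow, mul_comm (q ^ 2)⁻¹, ← mul_assoc,
    mul_inv_cancel₀ (pow_ne_zero m h2), one_mul]

/-- Commutator of `f` with powers of `e g`. -/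
theorem f_mul_pow (n : ℕ) :
    f * (-(q - q⁻¹) • (e * g)) ^ (n + 1) = (-(q - q⁻¹) • (e * g)) ^ (n + 1) * f +
      qParen q (n + 1) • ((-(q - q⁻¹) • (e * g)) ^ n * (k * g) -
        l * g * (-(q - q⁻¹) • (e * g)) ^ n) := by
  set A := -(q - q⁻¹) • (e * g) with hA
  have h2 := pow_ne_zero 2 hq.ne_zero
  have h3 := hq.sub_inv_ne_zero
  have hgA : Commute g A := (h.ge.mul_right (Commute.refl g)).smul_right _
  have hkA : QComm (q ^ 2) k A :=
    ((h.ke.mul_right (QComm.of_commute h.gk.symm)).of_eq (mul_one _)).smul_right _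
  have hlA : QComm (q ^ 2)⁻¹ l A :=
    (((h.le hq).mul_right (QComm.of_commute h.gl.symm)).of_eq (mul_one _)).smul_right _
  have hfA : f * A = A * f + (k * g - l * g) := by
    have : f * e = e * f - (q - q⁻¹)⁻¹ • (k - l) := by rw [← h.ef]; abel
    rw [hA, mul_smul_comm, ← mul_assoc, this, sub_mul, smul_sub, smul_mul_assoc, smul_mul_assoc,
      smul_smul, neg_mul, mul_inv_cancel₀ h3, mul_assoc, mul_assoc, h.gf.eq, sub_mul,
      neg_one_smul, sub_neg_eq_add]
  clear_value A
  induction n with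
  | zero => simp [hq.qParen_one, hfA]
  | succ n ih =>
    have e1 : k * g * A = q ^ 2 • (A * (k * g)) := by
      rw [mul_assoc, hgA.eq, ← mul_assoc, hkA, smul_mul_assoc, mul_assoc]
    have e2 : A ^ (n + 1) * (l * g) = (q ^ 2) ^ (n + 1) • (l * g * A ^ (n + 1)) := by
      have := (hlA.symm (inv_ne_zero h2)).pow_left (n + 1)
      rw [QComm, inv_inv] at this
      rw [← mul_assoc, this, smul_mul_assoc, mul_assoc, mul_assoc, (hgA.pow_right _).eq]
    have e3 : f * A ^ (n + 2) = A ^ (n + 1) * (A * f + (k * g - l * g)) +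
        qParen q (n + 1) • (A ^ n * (q ^ 2 • (A * (k * g))) - l * g * A ^ (n + 1)) := by
      rw [pow_succ A (n + 1), ← mul_assoc, ih, add_mul, mul_assoc _ f A, hfA, smul_mul_assoc, sub_mul,
        mul_assoc _ (k * g), e1, mul_assoc (l * g), ← pow_succ]
    -- The two recursions for (n+2)_q serve different terms: this one gives the coefficient of
    -- A^{n+1}kg, the next one that of lgA^{n+1}.
    have e4 : qParen q (n + 1 + 1) = 1 + q ^ 2 * qParen q (n + 1) := by
      rw [add_comm, hq.qParen_add, hq.qParen_one, pow_one]
    have e5 : qParen q (n + 1 + 1) = qParen q (n + 1) + (q ^ 2) ^ (n + 1) := by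
      rw [hq.qParen_add, hq.qParen_one, mul_one]
    rw [e3, mul_add, mul_sub, e2, mul_smul_comm, ← mul_assoc, ← pow_succ, ← mul_assoc (A ^ n),
      ← pow_succ, smul_sub (qParen q (n + 1 + 1)), smul_sub (qParen q (n + 1)), smul_smul]
    nth_rw 1 [e4]
    rw [e5]
    module

end

/-! ### Exchange relations between q-exponentials, and their limit. -/

section Matrix
variable {n : Type*} [Fintype n] [DecidableEq n] {q : ℂ} {e f k l g u : Matrix n n ℂ}
variable (h : DynRel q e f k l g u) (hq : IsGeneric q)
include h hq

theorem isNilpotent_twistArg : IsNilpotent (-(q - q⁻¹) • (e * g)) :=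
  (h.qcomm_u_eg.smul_right _).isNilpotent h.isUnit (hq.pow two_pos)

/-- `exp_q(-(q - q⁻¹) e ⊗ f)` intertwines the two opposite coproducts of `f`. -/
theorem semiconj_qExp :
    (f + l * g) * qExp q (-(q - q⁻¹) • (e * g)) =
      qExp q (-(q - q⁻¹) • (e * g)) * (f + k * g) := by
  set A := -(q - q⁻¹) • (e * g) with hA
  have hn : IsNilpotent A := h.isNilpotent_twistArg hq
  have hs := summable_qExpTerm (q := q) hn
  have hs' := (summable_nat_add_iff 1).mpr hs
  have h1 : ∀ i, f * qExpTerm q A (i + 1) = qExpTerm q A (i + 1) * f +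
      (qExpTerm q A i * (k * g) - l * g * qExpTerm q A i) := by
    intro i
    simp only [qExpTerm]
    rw [mul_smul_comm, h.f_mul_pow hq, smul_add, smul_smul, mul_comm _ (qParen q (i + 1)),
      hq.qParen_mul_inv_factorial, smul_sub, smul_mul_assoc, smul_mul_assoc, mul_smul_comm]
  have h2 : f * qExp q A = qExp q A * f + (qExp q A * (k * g) - l * g * qExp q A) := by
    rw [qExp, ← hs.tsum_mul_right, ← hs.tsum_mul_right, ← hs.tsum_mul_left, ← hs.tsum_mul_left,
      (hs.mul_left f).tsum_eq_zero_add, (hs.mul_right f).tsum_eq_zero_add, tsum_congr h1,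
      (hs'.mul_right f).tsum_add ((hs.mul_right _).sub (hs.mul_left _)),
      (hs.mul_right _).tsum_sub (hs.mul_left _), qExpTerm_zero, one_mul, mul_one, add_assoc]
  rw [add_mul, h2, mul_add]
  abel

theorem qExp_v_add (m : ℕ) : qExp q⁻¹ ((u * l) ^ m * (f + l * g)) =
    qExp q⁻¹ ((u * l) ^ m * (l * g)) * qExp q⁻¹ ((u * l) ^ m * f) := by
  have ht := hq.pow two_pos
  rw [mul_add, add_comm]
  refine qExp_add hq.inv ?_ ?_ ?_
  · rw [inv_pow]; exact h.qcomm_vf_vlg hq m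
  · exact (QComm.self_pow_mul m
      (((QComm.of_commute h.vl).mul_right h.vg).of_eq (one_mul _))).isNilpotent h.isUnit_v ht
  · exact (QComm.self_pow_mul m (h.vf hq)).isNilpotent h.isUnit_v ht

/-- Here the f factor stands on the left, whereas for f + lg it stands on the right. This reversal
is what makes the recombination of neighbouring factors possible. -/
theorem qExp_v_add' (m : ℕ) : qExp q⁻¹ ((u * l) ^ m * (f + k * g)) =
    qExp q⁻¹ ((u * l) ^ m * f) * qExp q⁻¹ ((u * l) ^ m * (k * g)) := by
  have ht := hq.pow two_pos
  rw [mul_add]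
  refine qExp_add hq.inv ?_ ?_ ?_
  · rw [inv_pow]; exact h.qcomm_vkg_vf hq m
  · exact (QComm.self_pow_mul m (h.vf hq)).isNilpotent h.isUnit_v ht
  · exact (QComm.self_pow_mul m
      (((QComm.of_commute h.vk).mul_right h.vg).of_eq (one_mul _))).isNilpotent h.isUnit_v ht

/-- Since e and g have opposite weights under v = ul, v commutes with eg, so the intertwining of f +
kg and f + lg survives multiplication by powers of v. -/
theorem semiconj_qExp_v (m : ℕ) :
    SemiconjBy (qExp q (-(q - q⁻¹) • (e * g)))
      (qExp q⁻¹ ((u * l) ^ m * (f + k * g))) (qExp q⁻¹ ((u * l) ^ m * (f + l * g))) := by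
  have ht := hq.pow two_pos
  have hn := h.isNilpotent_twistArg hq
  have hv : Commute (u * l) (-(q - q⁻¹) • (e * g)) :=
    ((((h.ve hq).mul_right h.vg).of_eq
      (inv_mul_cancel₀ (pow_ne_zero 2 hq.ne_zero))).commute).smul_right _
  have hv' : Commute (u * l) (qExp q (-(q - q⁻¹) • (e * g))) := qExp_semiconj hv hn hn
  refine qExp_semiconj ?_ ?_ ?_
  · rw [SemiconjBy, mul_assoc, h.semiconj_qExp hq, ← mul_assoc, ← (hv'.pow_left m).eq, mul_assoc]
  · exact (QComm.self_pow_mul m ((h.vf hq).add_right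
      (((QComm.of_commute h.vk).mul_right h.vg).of_eq (one_mul _)))).isNilpotent h.isUnit_v ht
  · exact (h.qcomm_v_add hq m).isNilpotent h.isUnit_v ht

/-- After the exchange and the splitting of every factor, v^2 k = l u^2 turns the kg part of factor
j+1 into an l u^2 g part at level j. The unpaired bottom factor is exp(ug), because vk = u. -/
theorem descProd_mul_qExp (m : ℕ) :
    descProd (fun j => qExp q⁻¹ ((u * l) ^ (2 * j + 1) * (f + l * g))) (m + 1) *
        qExp q (-(q - q⁻¹) • (e * g)) =
      qExp q (-(q - q⁻¹) • (e * g)) * (qExp q⁻¹ ((u * l) ^ (2 * m + 1) * f) *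
        descProd (fun j => qExp q⁻¹ ((u * l) ^ (2 * j + 1) * (f + l * (u ^ 2 * g)))) m *
        qExp q⁻¹ (u * g)) := by
  rw [← (descProd_semiconj (fun j => h.semiconj_qExp_v hq (2 * j + 1)) (m + 1)).eq,
    funext fun j => h.qExp_v_add' hq (2 * j + 1), descProd_mul_shift]
  have h1 : ∀ j : ℕ, (u * l) ^ (2 * (j + 1) + 1) * (k * g) =
      (u * l) ^ (2 * j + 1) * (l * (u ^ 2 * g)) := by
    intro j
    have : (u * l) ^ 2 * k = l * u ^ 2 := by
      rw [h.ul.mul_pow, pow_two l, mul_assoc, mul_assoc, h.lk, mul_one, (h.ul.pow_left 2).eq]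
    rw [show 2 * (j + 1) + 1 = 2 * j + 1 + 2 by ring, pow_add, mul_assoc, ← mul_assoc _ k g, this,
      mul_assoc l]
  have h2 : (u * l) ^ (2 * 0 + 1) * (k * g) = u * g := by
    rw [mul_zero, zero_add, pow_one, mul_assoc, ← mul_assoc l, h.lk, one_mul]
  have h3 : ∀ j : ℕ, qExp q⁻¹ ((u * l) ^ (2 * (j + 1) + 1) * (k * g)) *
      qExp q⁻¹ ((u * l) ^ (2 * j + 1) * f) =
      qExp q⁻¹ ((u * l) ^ (2 * j + 1) * (f + l * (u ^ 2 * g))) := fun j => by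
    rw [h1 j, (h.pow_mul 2).qExp_v_add hq (2 * j + 1)]
  rw [h2, funext h3]

/-- The elements ug and eg q-commute, so the left exponential splits as exp(ug) exp_{q^{-1}}(-A),
and the second factor is inverse to exp_q(A). -/
theorem qExp_w_mul :
    qExp q⁻¹ (u * g - -(q - q⁻¹) • (e * g)) * qExp q (-(q - q⁻¹) • (e * g)) =
      qExp q⁻¹ (u * g) := by
  have hn := h.isNilpotent_twistArg hq
  have h2 := pow_ne_zero 2 hq.ne_zero
  have hgg := QComm.of_commute (Commute.refl g)
  have hgu := h.ug.symm h2
  have hug : QComm (q ^ 2) u (u * g) :=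
    ((QComm.of_commute (Commute.refl u)).mul_right h.ug).of_eq (one_mul _)
  rw [sub_eq_add_neg, qExp_add hq.inv ?_ (hug.isNilpotent h.isUnit (hq.pow two_pos)) hn.neg,
    mul_assoc]
  · have := qExp_mul_qExp_inv hq.inv hn.neg
    rw [inv_inv, neg_neg] at this
    rw [this, mul_one]
  · rw [inv_pow, ← neg_smul]
    refine (((((QComm.of_commute h.ue.symm).mul_right (QComm.of_commute h.ge.symm))).mul_left
      (hgu.mul_right hgg)).smul_left _).of_eq ?_
    ring

theorem semiconj_NPlus {w : Matrix n n ℂ} (huw : u * w = 1) (hwu : w * u = 1) :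
    SemiconjBy (qExp q⁻¹ (-(q⁻¹ • (w * e)))) (qExp q⁻¹ (u * g))
      (qExp q⁻¹ (u * g - -(q - q⁻¹) • (e * g))) := by
  have h0 := hq.ne_zero
  have h2 := pow_ne_zero 2 hq.ne_zero
  set Z := -(q⁻¹ • (w * e)) with hZ
  have hwe : Commute w e := by
    calc w * e = w * (e * u) * w := by rw [mul_assoc, mul_assoc, huw, mul_one]
      _ = w * u * (e * w) := by rw [← h.ue.eq]; simp only [mul_assoc]
      _ = e * w := by rw [hwu, one_mul]
  have hwk : Commute k w := by
    calc k * w = w * u * (k * w) := by rw [hwu, one_mul]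
      _ = w * k * (u * w) := by rw [mul_assoc, ← mul_assoc u, h.uk.eq]; simp only [mul_assoc]
      _ = w * k := by rw [huw, mul_one]
  have hgw : QComm (q ^ 2) g w := by
    have := h.ug
    rw [QComm] at *
    calc g * w = w * (u * g) * w := by rw [← mul_assoc, hwu, one_mul]
      _ = q ^ 2 • (w * g * (u * w)) := by
        rw [this, mul_smul_comm, smul_mul_assoc]; simp only [mul_assoc]
      _ = _ := by rw [huw, mul_one]
  have hgZ : QComm (q ^ 2) g Z := by
    rw [hZ, ← neg_smul]
    exact ((hgw.mul_right (QComm.of_commute h.ge)).of_eq (mul_one _)).smul_right _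
  have hkZ : QComm (q ^ 2) k Z := by
    rw [hZ, ← neg_smul]
    exact (((QComm.of_commute hwk).mul_right h.ke).of_eq (one_mul _)).smul_right _
  have hZn : IsNilpotent Z :=
    hkZ.isNilpotent ⟨⟨k, l, h.kl, h.lk⟩, rfl⟩ (hq.pow two_pos)
  have huZ : Commute u Z := by
    rw [hZ, ← neg_smul]
    exact ((show Commute u w from huw.trans hwu.symm).mul_right h.ue).smul_right _
  have huN : Commute u (qExp q⁻¹ Z) := qExp_semiconj huZ hZn hZn
  have hNg : qExp q⁻¹ Z * g = (g + (q - q⁻¹) • (w * (e * g))) * qExp q⁻¹ Z := by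
    -- Moving g through exp(Z) rescales Z by q^{-2}. The q-difference equation then replaces the
    -- rescaled exponential by a linear factor times exp(Z), which is the source of the extra term
    -- in e g.
    have h3 : SemiconjBy g (q⁻¹ ^ 2 • Z) Z := by
      rw [SemiconjBy, mul_smul_comm, hgZ, smul_smul, inv_pow, inv_mul_cancel₀ h2, one_smul]
    rw [← (qExp_semiconj h3 (hZn.smul _) hZn).eq, qExp_sq_smul hq.inv hZn, ← mul_assoc, mul_add,
      mul_one, mul_smul_comm, hgZ, hZ, neg_mul, smul_mul_assoc, mul_assoc w e g, h.ge.eq.symm,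
      ← neg_smul, smul_smul, smul_smul]
    congr 3
    field_simp
    ring
  have hug : QComm (q ^ 2) u (u * g) :=
    ((QComm.of_commute (Commute.refl u)).mul_right h.ug).of_eq (one_mul _)
  have hw : u * g - -(q - q⁻¹) • (e * g) = u * (g + (q - q⁻¹) • (w * (e * g))) := by
    rw [mul_add, mul_smul_comm, ← mul_assoc u w, huw, one_mul, neg_smul, sub_neg_eq_add]
  refine qExp_semiconj ?_ (hug.isNilpotent h.isUnit (hq.pow two_pos)) ?_
  · rw [hw, SemiconjBy, ← mul_assoc, ← huN.eq, mul_assoc, hNg, mul_assoc]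
  · rw [sub_eq_add_neg, ← neg_smul]
    exact (hug.add_right (h.qcomm_u_eg.smul_right _)).isNilpotent h.isUnit (hq.pow two_pos)

open scoped Matrix.Norms.Operator in
/-- The dynamical coboundary equation in terms of the limits of the ordered products. -/
theorem coboundary (hu : ‖u‖ < 1) (hv : ‖u * l‖ < 1) {w F Δ N₁ N₂ : Matrix n n ℂ}
    (huw : u * w = 1) (hwu : w * u = 1)
    (hF : Tendsto (ascProd fun j => qExp q (-(q - q⁻¹) • (e * (u ^ (2 * j) * g)))) atTop (𝓝 F))
    (hΔ : Tendsto (descProd fun j => qExp q⁻¹ ((u * l) ^ (2 * j + 1) * (f + l * g))) atTop (𝓝 Δ))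
    (hN₁ : Tendsto (descProd fun j => qExp q⁻¹ ((u * l) ^ (2 * j + 1) * f)) atTop (𝓝 N₁))
    (hN₂ : Tendsto (descProd fun j => qExp q⁻¹ (u ^ (2 * j + 1) * g)) atTop (𝓝 N₂)) :
    Δ * qExp q⁻¹ (-(q⁻¹ • (w * e))) = F * N₁ * qExp q⁻¹ (-(q⁻¹ • (w * e))) * N₂ := by
  have ht := hq.pow two_pos
  have hnil : ∀ i j : ℕ,
      ((u * l) ^ (2 * j + 1) * (f + l * (u ^ i * g))) ^ Fintype.card n = 0 := fun i j =>
    ((h.pow_mul i).qcomm_v_add hq _).pow_card_eq_zero h.isUnit_v ht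
  -- P i is the infinite product for Δ(N_-) with g replaced by u^{2i}g.
  choose P _ hP using fun i : ℕ => exists_tendsto_descProd_qExp hq.inv hv (hnil (2 * i))
  have hP0 : P 0 = Δ := by
    refine tendsto_nhds_unique (hP 0) ?_
    simpa using hΔ
  have hone : Tendsto (fun m : ℕ => qExp q⁻¹ ((u * l) ^ (2 * m + 1) * f)) atTop (𝓝 1) := by
    refine tendsto_iff_norm_sub_tendsto_zero.mpr (squeeze_zero
      (fun _ => norm_nonneg _) (fun m => norm_qExp_pow_mul_sub_one_le hv le_rfl
      ((QComm.self_pow_mul _ (h.vf hq)).pow_card_eq_zero h.isUnit_v ht)) ?_)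
    simpa using (tendsto_pow_atTop_nhds_zero_of_lt_one (norm_nonneg _) hv).const_mul
      (qExpBound q⁻¹ (Fintype.card n) ‖f‖)
  have hstep : ∀ i, P i = qExp q (-(q - q⁻¹) • (e * (u ^ (2 * i) * g))) * P (i + 1) *
      qExp q⁻¹ (u * (u ^ (2 * i) * g) - -(q - q⁻¹) • (e * (u ^ (2 * i) * g))) := by
    intro i
    have hi := h.pow_mul (2 * i)
    have e1 := ((hP i).comp (tendsto_add_atTop_nat 1)).mul_const
      (qExp q (-(q - q⁻¹) • (e * (u ^ (2 * i) * g))))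
    have e2 := ((hone.mul (hP (i + 1))).mul_const
      (qExp q⁻¹ (u * (u ^ (2 * i) * g)))).const_mul (qExp q (-(q - q⁻¹) • (e * (u ^ (2 * i) * g))))
    have e3 := tendsto_nhds_unique e1 (e2.congr fun m => by
      have := hi.descProd_mul_qExp hq m
      rw [← mul_assoc (u ^ 2), ← pow_add, show 2 + 2 * i = 2 * (i + 1) by ring] at this
      exact this.symm)
    -- In the limit the leftover top factor has become 1. Writing exp(ug) as a product ending in
    -- exp_q(A) lets this exponential be cancelled on the right of both sides.
    rw [one_mul, ← hi.qExp_w_mul hq, ← mul_assoc, ← mul_assoc] at e3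
    have e4 := qExp_mul_qExp_inv hq (hi.isNilpotent_twistArg hq)
    have e5 := congrArg (· * qExp q⁻¹ (-(-(q - q⁻¹) • (e * (u ^ (2 * i) * g))))) e3
    simpa only [mul_assoc, e4, mul_one] using e5
  have hiter : ∀ m, Δ = ascProd (fun j => qExp q (-(q - q⁻¹) • (e * (u ^ (2 * j) * g)))) m * P m *
      descProd (fun j =>
        qExp q⁻¹ (u * (u ^ (2 * j) * g) - -(q - q⁻¹) • (e * (u ^ (2 * j) * g)))) m := by
    intro m
    induction m with
    | zero => rw [ascProd, descProd, one_mul, mul_one, hP0]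
    | succ m ih => rw [ih, hstep m, ascProd, descProd]; simp only [mul_assoc]
  -- As i grows, f + l u^{2i} g tends to f. Since ‖u‖ < 1, the constant M = ‖f‖ + ‖l‖‖g‖ bounds
  -- these elements for all i, giving one summable majorant for all the products.
  have hPlim : Tendsto P atTop (𝓝 N₁) := by
    set M := ‖f‖ + ‖l‖ * ‖g‖
    have hpow : ∀ i : ℕ, ‖u ^ (2 * i) * g‖ ≤ ‖g‖ := fun i =>
      (norm_pow_mul_le _ _ _).trans
        (mul_le_of_le_one_left (norm_nonneg _) (pow_le_one₀ (norm_nonneg _) hu.le))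
    have hug : Tendsto (fun i : ℕ => u ^ (2 * i) * g) atTop (𝓝 0) := by
      refine squeeze_zero_norm (fun i => norm_pow_mul_le u g (2 * i)) ?_
      have h3 : Tendsto (fun i : ℕ => 2 * i) atTop atTop :=
        tendsto_id.const_mul_atTop' two_pos
      simpa using
        ((tendsto_pow_atTop_nhds_zero_of_lt_one (norm_nonneg _) hu).comp h3).mul_const ‖g‖
    have hnf : ∀ j : ℕ, ((u * l) ^ (2 * j + 1) * f) ^ Fintype.card n = 0 := fun j =>
      (QComm.self_pow_mul _ (h.vf hq)).pow_card_eq_zero h.isUnit_v ht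
    refine tendsto_descProd_limit (summable_qExpBound (q := q⁻¹) (Fintype.card n) M hv)
      (fun j => norm_qExp_pow_mul_sub_one_le hv
        (le_add_of_nonneg_right (by positivity)) (hnf j))
      (fun i j => norm_qExp_pow_mul_sub_one_le hv ?_ (hnil (2 * i) j))
      (fun j => tendsto_qExp (fun i => hnil (2 * i) j) (hnf j) ?_) hP hN₁
    · exact (norm_add_le _ _).trans (add_le_add_right ((norm_mul_le _ _).trans
        (mul_le_mul_of_nonneg_left (hpow i) (norm_nonneg _))) _)
    · simpa using ((hug.const_mul l).const_add f).const_mul ((u * l) ^ (2 * j + 1))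
  have hfin : ∀ m, Δ * qExp q⁻¹ (-(q⁻¹ • (w * e))) =
      ascProd (fun j => qExp q (-(q - q⁻¹) • (e * (u ^ (2 * j) * g)))) m * P m *
      qExp q⁻¹ (-(q⁻¹ • (w * e))) * descProd (fun j => qExp q⁻¹ (u ^ (2 * j + 1) * g)) m := by
    intro m
    have e1 := descProd_semiconj (p := qExp q⁻¹ (-(q⁻¹ • (w * e))))
      (fun j => (h.pow_mul (2 * j)).semiconj_NPlus hq huw hwu) m
    simp only [← mul_assoc u, ← pow_succ'] at e1
    nth_rw 1 [hiter m]
    simp only [← mul_assoc u, ← pow_succ']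
    rw [mul_assoc, ← e1.eq, ← mul_assoc]
  exact tendsto_nhds_unique (tendsto_const_nhds.congr hfin) (((hF.mul hPlim).mul_const _).mul hN₂)

end Matrix
end DynRel

/-! ### The series and the product for the twist -/

theorem ascProd_add {R : Type*} [Monoid R] (A : ℕ → R) (m k : ℕ) :
    ascProd A (m + k) = ascProd A m * ascProd (fun i => A (m + i)) k := by
  induction k with
  | zero => simp [ascProd]
  | succ k ih => rw [← add_assoc, ascProd, ih, ascProd, mul_assoc]

theorem ascProd_semiconj {R : Type*} [Monoid R] {p : R} {A B : ℕ → R}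
    (h : ∀ k, SemiconjBy p (A k) (B k)) (m : ℕ) :
    SemiconjBy p (ascProd A m) (ascProd B m) := by
  induction m with
  | zero => exact SemiconjBy.one_right p
  | succ m ih => exact ih.mul_right (h m)

theorem isUnit_ascProd {R : Type*} [Monoid R] {A : ℕ → R} {m : ℕ}
    (h : ∀ k < m, IsUnit (A k)) : IsUnit (ascProd A m) := by
  induction m with
  | zero => exact isUnit_one
  | succ m ih => exact (ih fun k hk => h k (by omega)).mul (h m (by omega))

theorem map_ascProd {R S : Type*} [Monoid R] [Monoid S] (φ : R →* S) (A : ℕ → R) (m : ℕ) :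
    φ (ascProd A m) = ascProd (fun i => φ (A i)) m := by
  induction m with
  | zero => exact map_one φ
  | succ m ih => rw [ascProd, map_mul, ih, ascProd]

theorem ascProd_eq_prod {R : Type*} [CommMonoid R] (A : ℕ → R) (m : ℕ) :
    ascProd A m = ∏ i ∈ Finset.range m, A i := by
  induction m with
  | zero => rfl
  | succ m ih => rw [ascProd, ih, Finset.prod_range_succ]

/-! ### The commutative q-Vandermonde identity. -/

section Polynomial
variable {R : Type*} [CommRing R] [Algebra ℂ R] {q : ℂ}

/-- A finite `q`-Vandermonde type identity. -/
theorem sum_antidiagonal_qPochhammer (hq : IsGeneric q) (k : ℕ) (y : R) :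
    ∑ ij ∈ antidiagonal k, ((qParenFactorial q ij.1)⁻¹ * (qParenFactorial q ij.2)⁻¹ *
        (q ^ 2) ^ (ij.2 * (ij.2 - 1))) •
        (y ^ ij.2 * ∏ σ ∈ Finset.range ij.1, (1 - (q ^ 2) ^ (ij.2 + σ) • y)) =
      (qParenFactorial q k)⁻¹ • 1 := by
  induction k generalizing y with
  | zero => simp [qParenFactorial]
  | succ k ih =>
    have hne := hq.qParen_ne_zero k
    have key : qParen q (k + 1) • (∑ ij ∈ antidiagonal (k + 1),
        ((qParenFactorial q ij.1)⁻¹ * (qParenFactorial q ij.2)⁻¹ *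
        (q ^ 2) ^ (ij.2 * (ij.2 - 1))) •
        (y ^ ij.2 * ∏ σ ∈ Finset.range ij.1, (1 - (q ^ 2) ^ (ij.2 + σ) • y))) =
        (qParenFactorial q k)⁻¹ • 1 := by
      rw [Finset.smul_sum]
      have h1 : ∀ ij ∈ antidiagonal (k + 1), qParen q (k + 1) •
          ((qParenFactorial q ij.1)⁻¹ * (qParenFactorial q ij.2)⁻¹ *
          (q ^ 2) ^ (ij.2 * (ij.2 - 1))) •
          (y ^ ij.2 * ∏ σ ∈ Finset.range ij.1, (1 - (q ^ 2) ^ (ij.2 + σ) • y)) =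
          (qParen q ij.1 * (qParenFactorial q ij.1)⁻¹ * (qParenFactorial q ij.2)⁻¹ *
          (q ^ 2) ^ (ij.2 * (ij.2 - 1))) •
          (y ^ ij.2 * ∏ σ ∈ Finset.range ij.1, (1 - (q ^ 2) ^ (ij.2 + σ) • y)) +
          ((q ^ 2) ^ ij.1 * (qParenFactorial q ij.1)⁻¹ *
            (qParen q ij.2 * (qParenFactorial q ij.2)⁻¹) *
          (q ^ 2) ^ (ij.2 * (ij.2 - 1))) •
          (y ^ ij.2 * ∏ σ ∈ Finset.range ij.1, (1 - (q ^ 2) ^ (ij.2 + σ) • y)) := by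
        intro ij hij
        rw [← Finset.HasAntidiagonal.mem_antidiagonal.mp hij, hq.qParen_add, smul_smul,
          ← add_smul]
        congr 1
        ring
      rw [Finset.sum_congr rfl h1, Finset.sum_add_distrib, Finset.Nat.sum_antidiagonal_succ,
        Finset.Nat.sum_antidiagonal_succ' (n := k) (f := fun ij : ℕ × ℕ =>
          ((q ^ 2) ^ ij.1 * (qParenFactorial q ij.1)⁻¹ *
            (qParen q ij.2 * (qParenFactorial q ij.2)⁻¹) *
          (q ^ 2) ^ (ij.2 * (ij.2 - 1))) •
          (y ^ ij.2 * ∏ σ ∈ Finset.range ij.1, (1 - (q ^ 2) ^ (ij.2 + σ) • y)))]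
      simp only [IsGeneric.qParen_zero, zero_mul, mul_zero, zero_smul, zero_add]
      -- With S_k(y) the sum in question, the two halves are S_k(y)(1 - q^{2k}y) and S_k(q^2 y)
      -- q^{2k}y. The induction hypothesis, taken at both y and q^2 y, makes the dependence on y
      -- cancel.
      have h2 : ∀ ij ∈ antidiagonal k,
          (qParen q (ij.1 + 1) * (qParenFactorial q (ij.1 + 1))⁻¹ * (qParenFactorial q ij.2)⁻¹ *
          (q ^ 2) ^ (ij.2 * (ij.2 - 1))) •
          (y ^ ij.2 * ∏ σ ∈ Finset.range (ij.1 + 1), (1 - (q ^ 2) ^ (ij.2 + σ) • y)) =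
          (((qParenFactorial q ij.1)⁻¹ * (qParenFactorial q ij.2)⁻¹ *
          (q ^ 2) ^ (ij.2 * (ij.2 - 1))) •
          (y ^ ij.2 * ∏ σ ∈ Finset.range ij.1, (1 - (q ^ 2) ^ (ij.2 + σ) • y))) *
            (1 - (q ^ 2) ^ k • y) := by
        intro ij hij
        rw [← Finset.HasAntidiagonal.mem_antidiagonal.mp hij, hq.qParen_mul_inv_factorial,
          Finset.prod_range_succ, smul_mul_assoc, add_comm ij.2 ij.1,
          ← mul_assoc (y ^ ij.2)]
      have h3 : ∀ ij ∈ antidiagonal k,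
          ((q ^ 2) ^ ij.1 * (qParenFactorial q ij.1)⁻¹ *
            (qParen q (ij.2 + 1) * (qParenFactorial q (ij.2 + 1))⁻¹) *
          (q ^ 2) ^ ((ij.2 + 1) * (ij.2 + 1 - 1))) •
          (y ^ (ij.2 + 1) *
            ∏ σ ∈ Finset.range ij.1, (1 - (q ^ 2) ^ (ij.2 + 1 + σ) • y)) =
          (((qParenFactorial q ij.1)⁻¹ * (qParenFactorial q ij.2)⁻¹ *
          (q ^ 2) ^ (ij.2 * (ij.2 - 1))) •
          ((q ^ 2 • y) ^ ij.2 *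
            ∏ σ ∈ Finset.range ij.1, (1 - (q ^ 2) ^ (ij.2 + σ) • (q ^ 2 • y)))) *
            ((q ^ 2) ^ k • y) := by
        intro ij hij
        have hprod : ∀ σ : ℕ, (1 - (q ^ 2) ^ (ij.2 + σ) • (q ^ 2 • y)) =
            1 - (q ^ 2) ^ (ij.2 + 1 + σ) • y := by
          intro σ
          rw [smul_smul, ← pow_succ, add_right_comm]
        have hexp : (q ^ 2) ^ ij.1 * (q ^ 2) ^ ((ij.2 + 1) * (ij.2 + 1 - 1)) =
            (q ^ 2) ^ (ij.2 * (ij.2 - 1)) * (q ^ 2) ^ ij.2 * (q ^ 2) ^ (ij.1 + ij.2) := by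
          rw [← pow_add, ← pow_add, ← pow_add]
          congr 1
          rcases ij.2 with _ | j <;> simp
          ring
        rw [← Finset.HasAntidiagonal.mem_antidiagonal.mp hij, hq.qParen_mul_inv_factorial,
          Finset.prod_congr rfl fun σ _ => hprod σ]
        simp only [smul_pow, smul_mul_assoc, mul_smul_comm, smul_smul]
        congr 1
        · linear_combination (qParenFactorial q ij.1)⁻¹ * (qParenFactorial q ij.2)⁻¹ * hexp
        · ring
      rw [Finset.sum_congr rfl h2, Finset.sum_congr rfl h3, ← Finset.sum_mul, ← Finset.sum_mul,
        ih, ih, ← mul_add, sub_add_cancel, mul_one]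
    rw [← hq.qParen_mul_inv_factorial, mul_smul] at key
    exact smul_right_injective _ hne key

/-- The preceding identity at q^{2-4k}y, with the product read in reverse order. -/
theorem sum_antidiagonal_den (hq : IsGeneric q) (k : ℕ) (y : R) :
    ∑ ij ∈ antidiagonal k, ((qParenFactorial q ij.1)⁻¹ * (qParenFactorial q ij.2)⁻¹ *
        (q⁻¹ ^ 2) ^ (ij.2 * (ij.2 + 2 * ij.1))) •
        (ascProd (fun i => 1 - (q⁻¹ ^ 2) ^ (k + i) • y) ij.1 * y ^ ij.2) =
      (qParenFactorial q k)⁻¹ • 1 := by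
  have hts : q ^ 2 * q⁻¹ ^ 2 = 1 := by
    rw [← mul_pow, mul_inv_cancel₀ hq.ne_zero, one_pow]
  rw [← sum_antidiagonal_qPochhammer hq k ((q ^ 2 * (q⁻¹ ^ 2) ^ (2 * k)) • y)]
  refine Finset.sum_congr rfl fun ij hij => ?_
  have hk := Finset.HasAntidiagonal.mem_antidiagonal.mp hij
  have hprod : ascProd (fun i => 1 - (q⁻¹ ^ 2) ^ (k + i) • y) ij.1 =
      ∏ σ ∈ Finset.range ij.1,
        (1 - (q ^ 2) ^ (ij.2 + σ) • ((q ^ 2 * (q⁻¹ ^ 2) ^ (2 * k)) • y)) := by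
    rw [ascProd_eq_prod, ← Finset.prod_range_reflect]
    refine Finset.prod_congr rfl fun σ hσ => ?_
    have hσ' := Finset.mem_range.mp hσ
    rw [smul_smul]
    congr 2
    have : 2 * k = (ij.2 + σ + 1) + (k + (ij.1 - 1 - σ)) := by omega
    rw [← mul_assoc, ← pow_succ, this, pow_add _ (ij.2 + σ + 1), ← mul_assoc, ← mul_pow, hts,
      one_pow, one_mul]
  rw [hprod, smul_pow, smul_mul_assoc, smul_smul, mul_comm (y ^ _)]
  congr 1
  rw [mul_assoc _ ((q ^ 2) ^ _)]
  congr 1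
  have hexp : ij.2 * (2 * k) = ij.2 * (ij.2 - 1) + ij.2 + ij.2 * (ij.2 + 2 * ij.1) := by
    rw [← hk]
    rcases ij.2 with _ | j <;> simp
    ring
  rw [mul_pow, ← pow_mul (q⁻¹ ^ 2), mul_comm (2 * k), hexp, pow_add (q⁻¹ ^ 2) (_ + _),
    ← mul_assoc ((q ^ 2) ^ _) ((q ^ 2) ^ _), ← pow_add (q ^ 2), ← mul_assoc, ← mul_pow, hts,
    one_pow, one_mul]

end Polynomial

/-! ### Functional equation and product formula for Babelon's series. -/

section Twist
variable {n : Type*} [Fintype n] [DecidableEq n] {q : ℂ} {E A : Matrix n n ℂ}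

/-- `∏_{p=a}^{a+m-1} (1 - q^{-2p} E)`. -/
def denProd (q : ℂ) (E : Matrix n n ℂ) (a m : ℕ) : Matrix n n ℂ :=
  ascProd (fun i => 1 - (q⁻¹ ^ 2) ^ (a + i) • E) m

/-- `∑_k A^k / ((k)_q! ∏_{p=k}^{2k-1} (1 - q^{-2p} E))`, term by term. -/
def twistSeriesTerm (q : ℂ) (E A : Matrix n n ℂ) (k : ℕ) : Matrix n n ℂ :=
  (qParenFactorial q k)⁻¹ • ((denProd q E k k)⁻¹ * A ^ k)

theorem twistSeriesTerm_eq_zero {N : ℕ} (hA : A ^ N = 0) {k : ℕ} (hk : N ≤ k) :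
    twistSeriesTerm q E A k = 0 := by
  rw [twistSeriesTerm, pow_eq_zero_of_le hk hA, mul_zero, smul_zero]

theorem hasFiniteSupport_twistSeriesTerm (hA : IsNilpotent A) :
    (Function.support (twistSeriesTerm q E A)).Finite := by
  obtain ⟨N, hN⟩ := hA
  refine (Set.finite_lt_nat N).subset fun k hk => ?_
  by_contra hk'
  exact hk (twistSeriesTerm_eq_zero hN (not_lt.mp hk'))

theorem tsum_twistSeriesTerm {N : ℕ} (hA : A ^ N = 0) :
    ∑' k, twistSeriesTerm q E A k = ∑ k ∈ Finset.range N, twistSeriesTerm q E A k :=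
  tsum_eq_sum fun _ hk => twistSeriesTerm_eq_zero hA (by simpa using hk)

/-- Only the single matrix E occurs, so the identity in ℂ[X] can be evaluated at E. -/
theorem sum_antidiagonal_denProd (hq : IsGeneric q) (E : Matrix n n ℂ) (k : ℕ) :
    ∑ ij ∈ antidiagonal k, ((qParenFactorial q ij.1)⁻¹ * (qParenFactorial q ij.2)⁻¹ *
        (q⁻¹ ^ 2) ^ (ij.2 * (ij.2 + 2 * ij.1))) • (denProd q E k ij.1 * E ^ ij.2) =
      (qParenFactorial q k)⁻¹ • 1 := by
  have h := congrArg (Polynomial.aeval E) (sum_antidiagonal_den hq k (Polynomial.X : Polynomial ℂ))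
  rw [map_sum, map_smul, map_one] at h
  rw [← h]
  refine Finset.sum_congr rfl fun ij _ => ?_
  rw [map_smul, map_mul, map_pow, Polynomial.aeval_X, denProd]
  congr 2
  refine Eq.trans ?_ (map_ascProd (Polynomial.aeval E : Polynomial ℂ →ₐ[ℂ] _).toMonoidHom _ _).symm
  congr 1
  ext1 i
  change _ = Polynomial.aeval E _
  rw [map_sub, map_one, map_smul, Polynomial.aeval_X]

theorem mul_pow_of_qcomm_sq (hEA : QComm ((q⁻¹ ^ 2) ^ 2) A E) (j : ℕ) :
    (q⁻¹ ^ 2 • E * A) ^ j = (q⁻¹ ^ 2) ^ (j * j) • (E ^ j * A ^ j) := by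
  induction j with
  | zero => simp
  | succ j ih =>
    have h1 : A ^ j * E = ((q⁻¹ ^ 2) ^ 2) ^ j • (E * A ^ j) := hEA.pow_left j
    rw [pow_succ, ih, smul_mul_assoc (q⁻¹ ^ 2) E A, smul_mul_smul_comm,
      mul_assoc, ← mul_assoc (A ^ j), h1,
      smul_mul_assoc, mul_smul_comm, smul_smul, mul_assoc E, ← mul_assoc, ← pow_succ, ← pow_succ]
    congr 1
    ring

/-- Multiply by the denominator with p from k to 2k-1 and cut it after i factors. Moving A^i past E
shifts p by 2i, so the second part cancels the denominator of the j-th term. What remains is A^k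
times the polynomial identity in E. -/
theorem twistSeriesTerm_eq (hq : IsGeneric q) (hEA : QComm ((q⁻¹ ^ 2) ^ 2) A E) {k : ℕ}
    (hden : ∀ p < 2 * k, IsUnit (1 - (q⁻¹ ^ 2) ^ p • E)) :
    ∑ ij ∈ antidiagonal k,
      qExpTerm q A ij.1 * twistSeriesTerm q E (q⁻¹ ^ 2 • E * A) ij.2 = twistSeriesTerm q E A k := by
  have hunit : ∀ {a m : ℕ}, a + m ≤ 2 * k → IsUnit (denProd q E a m) := fun ham =>
    isUnit_ascProd fun i hi => hden _ (by omega)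
  have hterm : ∀ ij ∈ antidiagonal k, denProd q E k k *
      (qExpTerm q A ij.1 * twistSeriesTerm q E (q⁻¹ ^ 2 • E * A) ij.2) =
      (((qParenFactorial q ij.1)⁻¹ * (qParenFactorial q ij.2)⁻¹ *
        (q⁻¹ ^ 2) ^ (ij.2 * (ij.2 + 2 * ij.1))) • (denProd q E k ij.1 * E ^ ij.2)) * A ^ k := by
    intro ij hij
    have hk := Finset.HasAntidiagonal.mem_antidiagonal.mp hij
    have hsplit : denProd q E k k = denProd q E k ij.1 * denProd q E (k + ij.1) ij.2 := by
      conv_lhs => rw [denProd]; arg 2; rw [← hk]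
      rw [ascProd_add]
      simp only [denProd, add_assoc]
    have hsemi : SemiconjBy (A ^ ij.1) (denProd q E ij.2 ij.2) (denProd q E (k + ij.1) ij.2) := by
      refine ascProd_semiconj (fun i => ?_) _
      have h1 : A ^ ij.1 * E = ((q⁻¹ ^ 2) ^ 2) ^ ij.1 • (E * A ^ ij.1) := hEA.pow_left _
      rw [SemiconjBy, mul_sub, sub_mul, mul_one, one_mul, mul_smul_comm, h1, smul_mul_assoc,
        smul_smul, ← pow_mul (q⁻¹ ^ 2) 2, ← pow_add]
      congr 3
      omega
    have hinv : denProd q E (k + ij.1) ij.2 * (A ^ ij.1 * (denProd q E ij.2 ij.2)⁻¹) =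
        A ^ ij.1 := by
      rw [← mul_assoc, ← hsemi.eq, mul_assoc, Matrix.mul_nonsing_inv _
        ((Matrix.isUnit_iff_isUnit_det _).mp (hunit (by omega))), mul_one]
    have h2 : A ^ ij.1 * E ^ ij.2 = ((q⁻¹ ^ 2) ^ (2 * (ij.1 * ij.2))) • (E ^ ij.2 * A ^ ij.1) := by
      have := (hEA.pow_left ij.1).pow_right ij.2
      rw [QComm] at this
      rw [this, ← pow_mul, ← pow_mul]
    have h3 : denProd q E k ij.1 * denProd q E (k + ij.1) ij.2 *
        (A ^ ij.1 * ((denProd q E ij.2 ij.2)⁻¹ * (E ^ ij.2 * A ^ ij.2))) =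
        (q⁻¹ ^ 2) ^ (2 * (ij.1 * ij.2)) • (denProd q E k ij.1 * E ^ ij.2 * A ^ k) := by
      rw [← mul_assoc (A ^ ij.1), mul_assoc (denProd q E k ij.1), 
        ← mul_assoc (denProd q E (k + ij.1) ij.2),
        hinv, ← mul_assoc (A ^ ij.1), h2, smul_mul_assoc, mul_smul_comm, mul_assoc (E ^ ij.2),
        ← pow_add, hk, mul_assoc]
    rw [qExpTerm, twistSeriesTerm, mul_pow_of_qcomm_sq hEA, hsplit]
    simp only [mul_smul_comm, smul_mul_assoc, smul_smul]
    rw [h3, smul_smul]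
    congr 1
    ring
  have hmul : denProd q E k k * ∑ ij ∈ antidiagonal k,
      qExpTerm q A ij.1 * twistSeriesTerm q E (q⁻¹ ^ 2 • E * A) ij.2 =
      (qParenFactorial q k)⁻¹ • A ^ k := by
    rw [Finset.mul_sum, Finset.sum_congr rfl hterm, ← Finset.sum_mul, sum_antidiagonal_denProd hq,
      smul_mul_assoc, one_mul]
  rw [twistSeriesTerm, ← mul_smul_comm, ← hmul, ← mul_assoc, Matrix.nonsing_inv_mul _
    ((Matrix.isUnit_iff_isUnit_det _).mp (hunit (by omega))), one_mul]

open scoped Matrix.Norms.Operator in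
theorem tsum_twistSeriesTerm_eq (hq : IsGeneric q) (hEA : QComm ((q⁻¹ ^ 2) ^ 2) A E) {N : ℕ}
    (hA : A ^ N = 0) (hden : ∀ p < 4 * N, IsUnit (1 - (q⁻¹ ^ 2) ^ p • E)) :
    ∑' k, twistSeriesTerm q E A k =
      qExp q A * ∑' k, twistSeriesTerm q E (q⁻¹ ^ 2 • E * A) k := by
  have hA' : (q⁻¹ ^ 2 • E * A) ^ N = 0 := by
    rw [mul_pow_of_qcomm_sq hEA, hA, mul_zero, smul_zero]
  have h1 : Summable fun k => ‖qExpTerm q A k‖ :=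
    summable_of_hasFiniteSupport ((hasFiniteSupport_qExpTerm (q := q) ⟨N, hA⟩).subset
      fun k hk => by simpa using hk)
  have h2 : Summable fun k => ‖twistSeriesTerm q E (q⁻¹ ^ 2 • E * A) k‖ :=
    summable_of_hasFiniteSupport ((hasFiniteSupport_twistSeriesTerm (q := q) ⟨N, hA'⟩).subset
      fun k hk => by simpa using hk)
  refine Eq.trans ?_ (tsum_mul_tsum_eq_tsum_sum_antidiagonal_of_summable_norm h1 h2).symm
  refine tsum_congr fun k => ?_
  -- For k ≥ 2N one index of every pair is at least N and both sides vanish; below that, only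
  -- denominators with p < 2k < 4N are needed.
  by_cases hk : k < 2 * N
  · exact (twistSeriesTerm_eq hq hEA fun p hp => hden p (by omega)).symm
  · rw [twistSeriesTerm_eq_zero hA (by omega)]
    refine (Finset.sum_eq_zero fun ij hij => ?_).symm
    have hij' := Finset.HasAntidiagonal.mem_antidiagonal.mp hij
    by_cases hi : N ≤ ij.1
    · rw [qExpTerm_eq_zero hA hi, zero_mul]
    · rw [twistSeriesTerm_eq_zero hA' (by omega), mul_zero]

open scoped Matrix.Norms.Operator in
/-- The product formula for the twist. -/
theorem tendsto_twistProd (hq : IsGeneric q) {u : Matrix n n ℂ} (huA : QComm (q ^ 2) u A)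
    (hu : ‖u‖ < 1) (huU : IsUnit u) (hE : u ^ 2 = q⁻¹ ^ 2 • E)
    (hden : ∀ p < 4 * Fintype.card n, IsUnit (1 - (q⁻¹ ^ 2) ^ p • E)) :
    Tendsto (ascProd fun k => qExp q (u ^ (2 * k) * A)) atTop
      (𝓝 (∑' k, twistSeriesTerm q E A k)) := by
  have ht := hq.pow two_pos
  have h2 := pow_ne_zero 2 hq.ne_zero
  have hE' : E = q ^ 2 • u ^ 2 := by
    rw [hE, smul_smul, inv_pow, mul_inv_cancel₀ h2, one_smul]
  have huk : ∀ k : ℕ, QComm (q ^ 2) u (u ^ (2 * k) * A) := fun k => huA.self_pow_mul _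
  have hnil : ∀ k : ℕ, (u ^ (2 * k) * A) ^ Fintype.card n = 0 := fun k =>
    (huk k).pow_card_eq_zero huU ht
  have hEk : ∀ k : ℕ, QComm ((q⁻¹ ^ 2) ^ 2) (u ^ (2 * k) * A) E := fun k => by
    rw [hE', inv_pow]
    exact (((huk k).symm h2).pow_right 2).smul_right _
  have hstep : ∀ k : ℕ, ∑' i, twistSeriesTerm q E (u ^ (2 * k) * A) i =
      qExp q (u ^ (2 * k) * A) * ∑' i, twistSeriesTerm q E (u ^ (2 * (k + 1)) * A) i := by
    intro k
    rw [tsum_twistSeriesTerm_eq hq (hEk k) (hnil k) hden, ← hE, ← mul_assoc (u ^ 2), ← pow_add,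
      show 2 + 2 * k = 2 * (k + 1) by ring]
  have hiter : ∀ m : ℕ, ∑' i, twistSeriesTerm q E A i =
      ascProd (fun k => qExp q (u ^ (2 * k) * A)) m *
        ∑' i, twistSeriesTerm q E (u ^ (2 * m) * A) i := by
    intro m
    induction m with
    | zero => simp [ascProd]
    | succ m ih => rw [ih, hstep, ascProd, mul_assoc]
  have hpow : Tendsto (fun k : ℕ => u ^ (2 * k) * A) atTop (𝓝 0) := by
    refine squeeze_zero_norm (fun i => norm_pow_mul_le u A (2 * i)) ?_
    have h3 : Tendsto (fun i : ℕ => 2 * i) atTop atTop := tendsto_id.const_mul_atTop' two_pos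
    simpa using ((tendsto_pow_atTop_nhds_zero_of_lt_one (norm_nonneg _) hu).comp h3).mul_const ‖A‖
  have hlim : Tendsto (fun k : ℕ => ∑' i, twistSeriesTerm q E (u ^ (2 * k) * A) i) atTop
      (𝓝 1) := by
    -- The extra power keeps the term i = 0, the only one surviving at A = 0, in every truncated
    -- sum.
    have h0 : ∀ k : ℕ, (u ^ (2 * k) * A) ^ (Fintype.card n + 1) = 0 := fun k => by
      rw [pow_succ, hnil k, zero_mul]
    rw [funext fun k => tsum_twistSeriesTerm (h0 k)]
    have h3 : (1 : Matrix n n ℂ) =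
        ∑ i ∈ Finset.range (Fintype.card n + 1), twistSeriesTerm q E 0 i := by
      rw [Finset.sum_range_succ', Finset.sum_eq_zero]
      · simp [twistSeriesTerm, denProd, ascProd, qParenFactorial]
      · intro i _
        simp [twistSeriesTerm]
    rw [h3]
    exact tendsto_finsetSum _ fun i _ => ((hpow.pow i).const_mul _).const_smul _
  obtain ⟨F, hF⟩ := exists_tendsto_ascProd (A := fun k => qExp q (u ^ (2 * k) * A))
    (summable_qExpBound (q := q) (Fintype.card n) ‖A‖ hu) fun k =>
      norm_qExp_sub_one_le (hnil k) (norm_nonneg _) (by positivity)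
        (pow_le_one₀ (norm_nonneg _) hu.le) <| by
          rw [mul_comm ‖A‖]
          exact (norm_pow_mul_le _ _ _).trans (mul_le_mul_of_nonneg_right
            (pow_le_pow_of_le_one (norm_nonneg _) hu.le (Nat.le_mul_of_pos_left _ two_pos))
            (norm_nonneg _))
  have h4 := tendsto_nhds_unique (hF.mul hlim) (tendsto_const_nhds.congr hiter)
  rw [mul_one] at h4
  exact h4 ▸ hF

end Twist

/-! ### Consequences of the relations of `U_q(sl(2))` -/

theorem QComm.map {R S : Type*} [Ring R] [Algebra ℂ R] [Ring S] [Algebra ℂ S] {t : ℂ} {p a : R}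
    (h : QComm t p a) (φ : R →ₐ[ℂ] S) : QComm t (φ p) (φ a) := by
  rw [QComm] at *; rw [← map_mul, h, map_smul, map_mul]

namespace Uq
variable (q : ℂ)

/-- `q^h`. -/
def qh : Uq q := gen q .K ^ 2

/-- `q^{-h}`. -/
def qhInv : Uq q := gen q .Kinv ^ 2

theorem commute_K_Kinv : Commute (gen q .K) (gen q .Kinv) := (K_Kinv q).trans (Kinv_K q).symm

theorem qh_mul_qhInv : qh q * qhInv q = 1 := by
  rw [qh, qhInv, ← (commute_K_Kinv q).mul_pow, K_Kinv, one_pow]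

theorem qhInv_mul_qh : qhInv q * qh q = 1 := by
  rw [qh, qhInv, ← (commute_K_Kinv q).symm.mul_pow, Kinv_K, one_pow]

theorem qcomm_qh_e : QComm (q ^ 2) (qh q) (e q) :=
  (((QComm.of_commute (Commute.refl _)).mul_right (K_Ep q)).of_eq (one_mul q)).pow_left 2

theorem qcomm_qh_f : QComm (q ^ 2)⁻¹ (qh q) (f q) :=
  ((((show QComm q⁻¹ _ _ from K_Em q).mul_right (QComm.of_commute (commute_K_Kinv q))).of_eq
    (mul_one _)).pow_left 2).of_eq (inv_pow q 2)

variable {q}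

/-- K commutes with E_+E_-, so the factors q^{±h/2} drop out of ef and fe. -/
theorem e_f (hq : q ≠ 0) : e q * f q - f q * e q = (q - q⁻¹)⁻¹ • (qh q - qhInv q) := by
  have h1 : Commute (gen q .K) (gen q .Ep * gen q .Em) :=
    (((show QComm q _ _ from K_Ep q).mul_right (K_Em q)).of_eq (mul_inv_cancel₀ hq)).commute
  have h2 : e q * f q = gen q .Ep * gen q .Em := by
    calc e q * f q = gen q .K * (gen q .Ep * gen q .Em) * gen q .Kinv := by
          simp only [e, f, mul_assoc]
      _ = _ := by rw [h1.eq, mul_assoc, K_Kinv, mul_one]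
  have h3 : f q * e q = gen q .Em * gen q .Ep := by
    calc f q * e q = gen q .Em * (gen q .Kinv * gen q .K) * gen q .Ep := by
          simp only [e, f, mul_assoc]
      _ = _ := by rw [Kinv_K, mul_one]
  rw [h2, h3, Ep_Em, qh, qhInv]

end Uq

/-! ### Exponentials in representations -/

section Exponential
variable {η : ℂ} {m : Type*} [Fintype m] [DecidableEq m]
  {φ : Uq (Complex.exp η) →ₐ[ℂ] Matrix m m ℂ}

theorem map_qh_mul_map_qhInv (φ : Uq (Complex.exp η) →ₐ[ℂ] Matrix m m ℂ) :
    φ (Uq.qh _) * φ (Uq.qhInv _) = 1 := by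
  rw [← map_mul, Uq.qh_mul_qhInv, map_one]

theorem map_qhInv_mul_map_qh (φ : Uq (Complex.exp η) →ₐ[ℂ] Matrix m m ℂ) :
    φ (Uq.qhInv _) * φ (Uq.qh _) = 1 := by
  rw [← map_mul, Uq.qhInv_mul_qh, map_one]

open scoped Matrix.Norms.Operator in
theorem exp_smul_one (c : ℂ) :
    NormedSpace.exp (c • (1 : Matrix m m ℂ)) = Complex.exp c • 1 := by
  rw [← Algebra.algebraMap_eq_smul_one, ← Algebra.algebraMap_eq_smul_one, Complex.exp_eq_exp_ℂ]
  exact (NormedSpace.algebraMap_exp_comm c).symm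

theorem exp_smul_h (hφ : φ (Uq.gen _ .K) = NormedSpace.exp ((η / 2) • φ (Uq.gen _ .h))) :
    NormedSpace.exp (η • φ (Uq.gen _ .h)) = φ (Uq.qh _) := by
  rw [Uq.qh, map_pow, hφ, ← Matrix.exp_nsmul]
  congr 1
  module

theorem exp_neg_smul_h (hφ : φ (Uq.gen _ .K) = NormedSpace.exp ((η / 2) • φ (Uq.gen _ .h))) :
    NormedSpace.exp (-(η • φ (Uq.gen _ .h))) = φ (Uq.qhInv _) := by
  rw [Matrix.exp_neg, exp_smul_h hφ]
  exact Matrix.inv_eq_right_inv (map_qh_mul_map_qhInv φ)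

/-- Only integer powers of q^h occur in N and F. This replaces the matrix exponentials by powers of
an algebra element, after which only the algebra relations are used. -/
theorem exp_neg_mul_smul_h (hφ : φ (Uq.gen _ .K) = NormedSpace.exp ((η / 2) • φ (Uq.gen _ .h)))
    (c : ℂ) (r d : ℕ) (hc : c = -r) :
    NormedSpace.exp ((c * η) • (φ (Uq.gen _ .h) + (d : ℂ) • 1)) =
      ((Complex.exp η)⁻¹ ^ d • φ (Uq.qhInv _)) ^ r := by
  have h1 : (c * η) • (φ (Uq.gen _ .h) + (d : ℂ) • 1) =
      r • (-(η • φ (Uq.gen _ .h)) + (-(d * η)) • 1) := by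
    rw [hc]; module
  rw [h1, Matrix.exp_nsmul, Matrix.exp_add_of_commute, exp_neg_smul_h hφ, exp_smul_one,
    mul_smul_comm, mul_one, Complex.exp_neg, Complex.exp_nat_mul, inv_pow]
  exact (Commute.one_right _).smul_right _

theorem NMinusArg_eq (hφ : φ (Uq.gen _ .K) = NormedSpace.exp ((η / 2) • φ (Uq.gen _ .h)))
    {X Y : Matrix m m ℂ} (hXY : X * Y = 1) (hY : Commute Y (φ (Uq.qhInv _))) (k : ℕ) :
    NMinusArg φ X k =
      ((Complex.exp η)⁻¹ • (Y * φ (Uq.qhInv _))) ^ (2 * k + 1) * φ (Uq.f _) := by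
  have h1 := exp_neg_mul_smul_h hφ (-(2 * (k : ℂ) + 1)) (2 * k + 1) 1 (by push_cast; ring)
  rw [Nat.cast_one, one_smul] at h1
  rw [NMinusArg, h1, Matrix.inv_eq_right_inv hXY, ← (hY.symm.smul_left _).mul_pow, pow_one,
    smul_mul_assoc, hY.eq]

theorem qcomm_NPlusArg {X : Matrix m m ℂ} (hX : Commute (φ (Uq.qh _)) X) :
    QComm (Complex.exp η ^ 2) (φ (Uq.qh _)) (NPlusArg φ X) := by
  rw [NPlusArg, ← neg_one_smul ℂ]
  exact (((QComm.of_commute hX).mul_right ((Uq.qcomm_qh_e _).map φ)).of_eq (one_mul _)).smul_right _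

theorem isUnit_map_qh (φ : Uq (Complex.exp η) →ₐ[ℂ] Matrix m m ℂ) : IsUnit (φ (Uq.qh _)) :=
  ⟨⟨_, _, map_qh_mul_map_qhInv φ, map_qhInv_mul_map_qh φ⟩, rfl⟩

theorem isUnit_map_qhInv (φ : Uq (Complex.exp η) →ₐ[ℂ] Matrix m m ℂ) :
    IsUnit (φ (Uq.qhInv _)) :=
  ⟨⟨_, _, map_qhInv_mul_map_qh φ, map_qh_mul_map_qhInv φ⟩, rfl⟩

theorem isUnit_qExp {q : ℂ} (hq : IsGeneric q) {a : Matrix m m ℂ} (ha : IsNilpotent a) :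
    IsUnit (qExp q a) := by
  rw [Matrix.isUnit_iff_isUnit_det]
  exact Matrix.isUnit_det_of_right_inverse (qExp_mul_qExp_inv hq ha)

theorem qcomm_qhInv_f (hq : IsGeneric (Complex.exp η))
    (φ : Uq (Complex.exp η) →ₐ[ℂ] Matrix m m ℂ) :
    QComm (Complex.exp η ^ 2) (φ (Uq.qhInv _)) (φ (Uq.f _)) := by
  have h2 := pow_ne_zero 2 hq.ne_zero
  have h := (Uq.qcomm_qh_f (Complex.exp η)).map φ
  rw [QComm] at *
  calc φ (Uq.qhInv _) * φ (Uq.f _)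
      = φ (Uq.qhInv _) * (φ (Uq.f _) * φ (Uq.qh _)) * φ (Uq.qhInv _) := by
        rw [mul_assoc, mul_assoc, map_qh_mul_map_qhInv, mul_one]
    _ = Complex.exp η ^ 2 • (φ (Uq.qhInv _) * φ (Uq.qh _) * (φ (Uq.f _) * φ (Uq.qhInv _))) := by
        rw [← one_smul ℂ (φ (Uq.f _) * φ (Uq.qh _)), ← mul_inv_cancel₀ h2, mul_smul, ← h,
          mul_smul_comm, smul_mul_assoc]
        simp only [mul_assoc]
    _ = _ := by rw [map_qhInv_mul_map_qh, one_mul]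

open scoped Matrix.Norms.Operator in
/-- Convergence of the product `N(X)` for `X⁻¹ = Y` small. -/
theorem nConverges (hq : IsGeneric (Complex.exp η))
    (hφ : φ (Uq.gen _ .K) = NormedSpace.exp ((η / 2) • φ (Uq.gen _ .h)))
    {X Y : Matrix m m ℂ} (hXY : X * Y = 1) (hX : Commute X (φ (Uq.qh _)))
    (hY : Commute Y (φ (Uq.qhInv _))) (hYf : Commute Y (φ (Uq.f _)))
    (hv : ‖(Complex.exp η)⁻¹ • (Y * φ (Uq.qhInv _))‖ < 1) :
    NConverges φ X ∧ IsUnit (NElt φ X) := by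
  set v := (Complex.exp η)⁻¹ • (Y * φ (Uq.qhInv _)) with hvdef
  have hYX : Y * X = 1 := mul_eq_one_comm.mp hXY
  have hYu : IsUnit Y := ⟨⟨Y, X, hYX, hXY⟩, rfl⟩
  have ht := hq.pow two_pos
  have hvu : IsUnit v :=
    (hYu.mul (isUnit_map_qhInv φ)).smul (Units.mk0 _ (inv_ne_zero hq.ne_zero))
  have hvf : QComm (Complex.exp η ^ 2) v (φ (Uq.f _)) :=
    (((QComm.of_commute hYf).mul_left (qcomm_qhInv_f hq φ)).of_eq (one_mul _)).smul_left _
  have hnil : ∀ k : ℕ, (v ^ (2 * k + 1) * φ (Uq.f _)) ^ Fintype.card m = 0 := fun k =>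
    (hvf.self_pow_mul _).pow_card_eq_zero hvu ht
  have hplus : IsNilpotent (NPlusArg φ X) :=
    (qcomm_NPlusArg hX.symm).isNilpotent (isUnit_map_qh φ) ht
  obtain ⟨L, hL, hLt⟩ := exists_tendsto_descProd_qExp hq.inv hv hnil
  have hpart : NMinusPartial φ X =
      descProd fun k => qExp (Complex.exp η)⁻¹ (v ^ (2 * k + 1) * φ (Uq.f _)) := by
    rw [NMinusPartial]
    congr 1
    ext1 k
    rw [NMinusArg_eq hφ hXY hY]
  rw [← hpart] at hLt
  have hN : NMinus φ X = L := hLt.limUnder_eq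
  refine ⟨⟨⟨⟨X, Y, hXY, hYX⟩, rfl⟩, summable_qExpTerm hplus, fun k => ?_, hN ▸ hLt⟩, ?_⟩
  · rw [NMinusArg_eq hφ hXY hY]
    exact summable_qExpTerm ⟨_, hnil k⟩
  · rw [NElt, hN]
    exact hL.mul (isUnit_qExp hq.inv hplus)

end Exponential

/-! ### The two factors of a tensor product -/

section Tensor
variable {η : ℂ} {ι κ : Type*} [Fintype ι] [DecidableEq ι] [Fintype κ] [DecidableEq κ]
  (V : UqRep η ι) (W : UqRep η κ)

theorem act₁_apply (a : Uq (Complex.exp η)) : act₁ V W a = kronLeft ι κ (V.toHom a) := by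
  simp [act₁, tensorAction]

theorem act₂_apply (a : Uq (Complex.exp η)) : act₂ V W a = kronRight ι κ (W.toHom a) := by
  simp [act₂, tensorAction]

theorem tensorAction_eq_mul (a b : Uq (Complex.exp η)) :
    tensorAction V W (a ⊗ₜ b) = act₁ V W a * act₂ V W b := by
  simp [act₁, act₂, tensorAction]

theorem act₁_commute_act₂ (a b : Uq (Complex.exp η)) : Commute (act₁ V W a) (act₂ V W b) := by
  change act₁ V W a * act₂ V W b = act₂ V W b * act₁ V W a
  simp only [act₁, act₂, AlgHom.comp_apply, ← map_mul]
  simp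

open scoped Matrix.Norms.Operator in
theorem act₁_map_K :
    act₁ V W (Uq.gen _ .K) = NormedSpace.exp ((η / 2) • act₁ V W (Uq.gen _ .h)) := by
  rw [act₁_apply, act₁_apply, V.map_K, ← map_smul (kronLeft ι κ)]
  exact NormedSpace.map_exp (𝔸 := Matrix ι ι ℂ) (kronLeft ι κ)
    (kronLeft ι κ).toLinearMap.continuous_of_finiteDimensional _

open scoped Matrix.Norms.Operator in
theorem act₂_map_K :
    act₂ V W (Uq.gen _ .K) = NormedSpace.exp ((η / 2) • act₂ V W (Uq.gen _ .h)) := by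
  rw [act₂_apply, act₂_apply, W.map_K, ← map_smul (kronRight ι κ)]
  exact NormedSpace.map_exp (𝔸 := Matrix κ κ ℂ) (kronRight ι κ)
    (kronRight ι κ).toLinearMap.continuous_of_finiteDimensional _

theorem actΔ_gen (g : UqGen) :
    actΔ V W (Uq.gen _ g) = tensorAction V W (Uq.comulGen _ g) := by
  simp [actΔ, Uq.comul, Uq.gen]

theorem actΔ_K : actΔ V W (Uq.gen _ .K) = act₁ V W (Uq.gen _ .K) * act₂ V W (Uq.gen _ .K) := by
  rw [actΔ_gen, Uq.comulGen, tensorAction_eq_mul]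

theorem actΔ_Kinv :
    actΔ V W (Uq.gen _ .Kinv) = act₁ V W (Uq.gen _ .Kinv) * act₂ V W (Uq.gen _ .Kinv) := by
  rw [actΔ_gen, Uq.comulGen, tensorAction_eq_mul]

theorem actΔ_qhInv :
    actΔ V W (Uq.qhInv _) = act₁ V W (Uq.qhInv _) * act₂ V W (Uq.qhInv _) := by
  rw [Uq.qhInv, map_pow, actΔ_Kinv, (act₁_commute_act₂ V W _ _).mul_pow, map_pow, map_pow]

/-- The factor q^{h_2} on e_1 is the origin of the dynamical shift x q^{h_2} in N_1. -/
theorem actΔ_e : actΔ V W (Uq.e _) =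
    act₂ V W (Uq.qh _) * act₁ V W (Uq.e _) + act₂ V W (Uq.e _) := by
  have h1 : actΔ V W (Uq.gen _ .Ep) = act₁ V W (Uq.gen _ .Ep) * act₂ V W (Uq.gen _ .K) +
      act₁ V W (Uq.gen _ .Kinv) * act₂ V W (Uq.gen _ .Ep) := by
    rw [actΔ_gen, Uq.comulGen, map_add, tensorAction_eq_mul, tensorAction_eq_mul]
  have h2 : act₁ V W (Uq.gen _ .K) * act₁ V W (Uq.gen _ .Kinv) = 1 := by
    rw [← map_mul, Uq.K_Kinv, map_one]
  have hc := act₁_commute_act₂ V W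
  rw [Uq.e, map_mul, actΔ_K, h1, mul_add]
  congr 1
  · rw [(hc _ _).eq, mul_assoc, ← mul_assoc (act₁ V W _) (act₁ V W _), ← map_mul,
      (hc _ _).eq, ← mul_assoc, ← map_mul, Uq.qh, pow_two]
  · rw [(hc _ _).eq, mul_assoc, ← mul_assoc (act₁ V W _) (act₁ V W _), h2, one_mul, ← map_mul]

theorem actΔ_f : actΔ V W (Uq.f _) =
    act₁ V W (Uq.f _) + act₁ V W (Uq.qhInv _) * act₂ V W (Uq.f _) := by
  have h1 : actΔ V W (Uq.gen _ .Em) = act₁ V W (Uq.gen _ .Em) * act₂ V W (Uq.gen _ .K) +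
      act₁ V W (Uq.gen _ .Kinv) * act₂ V W (Uq.gen _ .Em) := by
    rw [actΔ_gen, Uq.comulGen, map_add, tensorAction_eq_mul, tensorAction_eq_mul]
  have h2 : act₂ V W (Uq.gen _ .K) * act₂ V W (Uq.gen _ .Kinv) = 1 := by
    rw [← map_mul, Uq.K_Kinv, map_one]
  have hc := act₁_commute_act₂ V W
  rw [Uq.f, map_mul, actΔ_Kinv, h1, add_mul]
  congr 1
  · rw [(hc (Uq.gen _ .Kinv) _).eq, mul_assoc, ← mul_assoc (act₂ V W _) (act₂ V W _), h2,
      one_mul, ← map_mul]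
  · rw [mul_assoc, ← mul_assoc (act₂ V W _) (act₁ V W _), ← (hc _ _).eq, mul_assoc (act₁ V W _),
      ← map_mul, ← mul_assoc, ← map_mul, Uq.qhInv, pow_two]

/-- `x^{-1} q^{-1-h_2}`. -/
def dynParam (x : ℂ) : Matrix (ι × κ) (ι × κ) ℂ :=
  ((Complex.exp η)⁻¹ * x⁻¹) • act₂ V W (Uq.qhInv _)

theorem dynRel (hq : IsGeneric (Complex.exp η)) {x : ℂ} (hx : x ≠ 0) :
    DynRel (Complex.exp η) (act₁ V W (Uq.e _)) (act₁ V W (Uq.f _)) (act₁ V W (Uq.qh _))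
      (act₁ V W (Uq.qhInv _)) (act₂ V W (Uq.f _)) (dynParam V W x) where
  kl := map_qh_mul_map_qhInv _
  lk := map_qhInv_mul_map_qh _
  ke := (Uq.qcomm_qh_e _).map _
  kf := (Uq.qcomm_qh_f _).map _
  ef := by rw [← map_mul, ← map_mul, ← map_sub, Uq.e_f hq.ne_zero, map_smul, map_sub]
  ge := (act₁_commute_act₂ V W _ _).symm
  gf := (act₁_commute_act₂ V W _ _).symm
  gk := (act₁_commute_act₂ V W _ _).symm
  ue := (act₁_commute_act₂ V W _ _).symm.smul_left _
  uf := (act₁_commute_act₂ V W _ _).symm.smul_left _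
  uk := (act₁_commute_act₂ V W _ _).symm.smul_left _
  ug := (qcomm_qhInv_f hq _).smul_left _
  isUnit := (isUnit_map_qhInv _).smul
    (Units.mk0 _ (mul_ne_zero (inv_ne_zero hq.ne_zero) (inv_ne_zero hx)))

/-- `x^{-2} q^{-2h_2}`. -/
def twistParam (x : ℂ) : Matrix (ι × κ) (ι × κ) ℂ := (x ^ 2)⁻¹ • act₂ V W (Uq.qhInv _) ^ 2

theorem dynParam_sq (x : ℂ) :
    dynParam V W x ^ 2 = (Complex.exp η)⁻¹ ^ 2 • twistParam V W x := by
  rw [dynParam, twistParam, smul_pow, smul_smul, mul_pow, inv_pow x]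

theorem twistDen_eq (x : ℂ) (k : ℕ) :
    twistDen V W x k = denProd (Complex.exp η) (twistParam V W x) k k := by
  rw [twistDen, denProd]
  congr 1
  ext1 i
  rw [twistDenFactor, qPowH₂, exp_neg_mul_smul_h (act₂_map_K V W) (-2) 2 (k + i) (by norm_num),
    twistParam, smul_pow, ← pow_mul, ← pow_mul, mul_comm (k + i), smul_comm]

theorem tensorAction_pow (k : ℕ) : tensorAction V W ((Uq.e _ ^ k) ⊗ₜ (Uq.f _ ^ k)) =
    (act₁ V W (Uq.e _) * act₂ V W (Uq.f _)) ^ k := by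
  rw [tensorAction_eq_mul, (act₁_commute_act₂ V W _ _).mul_pow, map_pow, map_pow]

/-- The power q^{k(1-k)} is exactly what converts (k)_{q^{-1}}! into (k)_q!. -/
theorem twistTerm_eq (hq : IsGeneric (Complex.exp η)) (x : ℂ) (k : ℕ) :
    twistTerm V W x k = twistSeriesTerm (Complex.exp η) (twistParam V W x)
      (-(Complex.exp η - (Complex.exp η)⁻¹) • (act₁ V W (Uq.e _) * act₂ V W (Uq.f _))) k := by
  rw [twistTerm, twistSeriesTerm, twistDen_eq, tensorAction_pow, smul_pow, mul_smul_comm, smul_smul]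
  congr 1
  have h0 := hq.ne_zero
  have h1 := hq.inv.qParenFactorial_ne_zero k
  have h2 : Complex.exp η ^ ((k : ℤ) * (1 - k)) = (Complex.exp η ^ (k * (k - 1)))⁻¹ := by
    rw [← zpow_natCast, ← zpow_neg]
    congr 1
    rcases k with _ | k
    · simp
    · push_cast [Nat.add_sub_cancel]; ring
  rw [h2, hq.qParenFactorial_inv k, mul_inv, neg_pow (_ - _) k, div_eq_mul_inv]
  ring

theorem twistProdArg_eq (x : ℂ) (k : ℕ) :
    twistProdArg V W x k = dynParam V W x ^ (2 * k) *
      (-(Complex.exp η - (Complex.exp η)⁻¹) • (act₁ V W (Uq.e _) * act₂ V W (Uq.f _))) := by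
  have h1 := exp_neg_mul_smul_h (act₂_map_K V W) (-2 * k) (2 * k) 1 (by push_cast; ring)
  rw [Nat.cast_one] at h1
  rw [twistProdArg, qPowH₂, h1, tensorAction_eq_mul, dynParam, smul_pow, smul_pow, mul_smul_comm,
    smul_mul_assoc, smul_mul_assoc, smul_smul, smul_smul, mul_pow, pow_one, inv_pow x]
  congr 1
  ring

theorem qPowH₂_one_zero : qPowH₂ V W 1 0 = act₂ V W (Uq.qh _) := by
  rw [qPowH₂, one_mul, zero_smul, add_zero, exp_smul_h (act₂_map_K V W)]

end Tensor

/-! ### The coboundary equation -/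

section Main
open scoped Matrix.Norms.Operator

theorem eventually_norm_inv_pow_smul_lt_one {m : Type*} [Fintype m] [DecidableEq m]
    (a : Matrix m m ℂ) {k : ℕ} (hk : k ≠ 0) :
    ∀ᶠ x in Bornology.cobounded ℂ, ‖x⁻¹ ^ k • a‖ < 1 := by
  have h : Tendsto (fun x : ℂ => ‖x⁻¹ ^ k • a‖) (Bornology.cobounded ℂ) (𝓝 0) := by
    have := (((tendsto_inv₀_cobounded (α := ℂ)).pow k).smul_const a).norm
    simpa [hk] using this
  exact h.eventually_lt_const one_pos

variable {η : ℂ} {ι κ : Type*} [Fintype ι] [DecidableEq ι] [Fintype κ] [DecidableEq κ]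

theorem nConverges_smul_one {m : Type*} [Fintype m] [DecidableEq m]
    {φ : Uq (Complex.exp η) →ₐ[ℂ] Matrix m m ℂ} (hq : IsGeneric (Complex.exp η))
    (hφ : φ (Uq.gen _ .K) = NormedSpace.exp ((η / 2) • φ (Uq.gen _ .h))) {x : ℂ} (hx : x ≠ 0)
    (hv : ‖x⁻¹ ^ 1 • ((Complex.exp η)⁻¹ • φ (Uq.qhInv _))‖ < 1) :
    NConverges φ (x • 1) ∧ IsUnit (NElt φ (x • 1)) := by
  refine nConverges hq hφ (Y := x⁻¹ • 1) ?_ ((Commute.one_left _).smul_left _)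
    ((Commute.one_left _).smul_left _) ((Commute.one_left _).smul_left _) ?_
  · rw [smul_mul_smul_comm, mul_inv_cancel₀ hx, one_mul, one_smul]
  · rwa [smul_mul_assoc, one_mul, smul_comm, ← pow_one x⁻¹]

theorem NMinusPartial_smul_one {m : Type*} [Fintype m] [DecidableEq m]
    {φ : Uq (Complex.exp η) →ₐ[ℂ] Matrix m m ℂ}
    (hφ : φ (Uq.gen _ .K) = NormedSpace.exp ((η / 2) • φ (Uq.gen _ .h))) {x : ℂ} (hx : x ≠ 0) :
    NMinusPartial φ (x • 1) = descProd fun j => qExp (Complex.exp η)⁻¹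
      ((((Complex.exp η)⁻¹ * x⁻¹) • φ (Uq.qhInv _)) ^ (2 * j + 1) * φ (Uq.f _)) := by
  rw [NMinusPartial]
  congr 1
  ext1 j
  rw [NMinusArg_eq hφ (Y := x⁻¹ • 1) ?_ ((Commute.one_left _).smul_left _), smul_mul_assoc,
    one_mul, smul_smul]
  rw [smul_mul_smul_comm, mul_inv_cancel₀ hx, one_mul, one_smul]

end Main

theorem mainTheorem1 (η : ℂ) (hη : ∀ n : ℕ, 0 < n → Complex.exp η ^ n ≠ 1)
    {ι κ : Type*} [Fintype ι] [DecidableEq ι] [Fintype κ] [DecidableEq κ]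
    (V : UqRep η ι) (W : UqRep η κ) :
    ∃ r : ℝ, 0 < r ∧ ∀ x : ℂ, r < ‖x‖ →
      -- `F(x)` is well defined, by the series and by the infinite product
      TwistConverges V W x ∧
      (∀ k, Summable (qExpTerm (Complex.exp η) (twistProdArg V W x k))) ∧
      Tendsto (twistProdPartial V W x) atTop (𝓝 (twist V W x)) ∧
      -- the infinite products defining `N(x)` converge
      NConverges V.toHom (x • 1) ∧
      NConverges W.toHom (x • 1) ∧
      NConverges (V.tensor W).toHom (x • 1) ∧
      NConverges (act₂ V W) (x • 1) ∧
      NConverges (act₁ V W) (x • qPowH₂ V W 1 0) ∧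
      -- the coboundary equation
      IsUnit (N₂ V W x) ∧
      IsUnit (N₁shift V W x) ∧
      twist V W x = NΔ V W x * (N₂ V W x)⁻¹ * (N₁shift V W x)⁻¹ := by
  have hq : IsGeneric (Complex.exp η) := ⟨Complex.exp_ne_zero η, hη⟩
  have h0 := hq.ne_zero
  have ht := hq.pow two_pos
  -- Finitely many smallness conditions, each satisfied near infinity: four for the products N, the
  -- rest for invertibility of the denominators by a Neumann series.
  open scoped Matrix.Norms.Operator in
  have hev := (eventually_norm_inv_pow_smul_lt_one
      ((Complex.exp η)⁻¹ • V.toHom (Uq.qhInv _)) one_ne_zero).and <|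
    (eventually_norm_inv_pow_smul_lt_one
      ((Complex.exp η)⁻¹ • W.toHom (Uq.qhInv _)) one_ne_zero).and <|
    (eventually_norm_inv_pow_smul_lt_one
      ((Complex.exp η)⁻¹ • (V.tensor W).toHom (Uq.qhInv _)) one_ne_zero).and <|
    (eventually_norm_inv_pow_smul_lt_one
      ((Complex.exp η)⁻¹ • act₂ V W (Uq.qhInv _)) one_ne_zero).and <|
    (Filter.eventually_all_finset (Finset.range (4 * Fintype.card (ι × κ)))).mpr fun p _ =>
      eventually_norm_inv_pow_smul_lt_one
        (((Complex.exp η)⁻¹ ^ 2) ^ p • act₂ V W (Uq.qhInv _) ^ 2) two_ne_zero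
  obtain ⟨r, -, hr⟩ := (hasBasis_cobounded_norm (E := ℂ)).eventually_iff.mp hev
  -- The maximum with 1 secures positivity and x ≠ 0.
  refine ⟨max r 1, by positivity, fun x hx => ?_⟩
  obtain ⟨hV, hW, hVW, h2, hden⟩ := hr ((le_max_left r 1).trans hx.le)
  have hx0 : x ≠ 0 := norm_pos_iff.mp (one_pos.trans_le ((le_max_right r 1).trans hx.le))
  have hrel := dynRel V W hq hx0
  have hc := act₁_commute_act₂ V W
  set u := dynParam V W x with hu
  set A := -(Complex.exp η - (Complex.exp η)⁻¹) • (act₁ V W (Uq.e _) * act₂ V W (Uq.f _)) with hA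
  have huA : QComm (Complex.exp η ^ 2) u A := hrel.qcomm_u_eg.smul_right _
  have hden' : ∀ p < 4 * Fintype.card (ι × κ),
      IsUnit (1 - ((Complex.exp η)⁻¹ ^ 2) ^ p • twistParam V W x) := by
    intro p hp
    refine isUnit_one_sub_of_norm_lt_one ?_
    rw [twistParam, smul_comm, ← inv_pow]
    exact hden p (Finset.mem_range.mpr hp)
  have hterm : twistTerm V W x = twistSeriesTerm (Complex.exp η) (twistParam V W x) A :=
    funext (twistTerm_eq V W hq x)
  have hAnil : IsNilpotent A := huA.isNilpotent hrel.isUnit ht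
  have hu1 : ‖u‖ < 1 := by
    rw [hu, dynParam, mul_comm, ← smul_smul, ← pow_one x⁻¹]; exact h2
  -- Since q^{-h} is group-like, one bound controls both Δ(N(x)) and N_1(x q^{h_2}).
  have hul : u * act₁ V W (Uq.qhInv _) =
      ((Complex.exp η)⁻¹ * x⁻¹) • (V.tensor W).toHom (Uq.qhInv _) := by
    change _ = _ • actΔ V W _
    rw [hu, dynParam, smul_mul_assoc, actΔ_qhInv, (hc _ _).eq]
  have hv1 : ‖u * act₁ V W (Uq.qhInv _)‖ < 1 := by
    rw [hul, mul_comm, ← smul_smul, ← pow_one x⁻¹]; exact hVW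
  have hF : Tendsto (ascProd fun k => qExp (Complex.exp η) (u ^ (2 * k) * A)) atTop
      (𝓝 (twist V W x)) := by
    rw [twist, hterm]
    exact tendsto_twistProd hq huA hu1 hrel.isUnit (dynParam_sq V W x) hden'
  have hNV := (nConverges_smul_one hq V.map_K hx0 hV).1
  have hNW := (nConverges_smul_one hq W.map_K hx0 hW).1
  have hNΔ := (nConverges_smul_one hq (V.tensor W).map_K hx0 hVW).1
  obtain ⟨hN2, hN2u⟩ := nConverges_smul_one hq (act₂_map_K V W) hx0 h2
  have hXY : (x • qPowH₂ V W 1 0) * (x⁻¹ • act₂ V W (Uq.qhInv _)) = 1 := by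
    rw [qPowH₂_one_zero, smul_mul_smul_comm, mul_inv_cancel₀ hx0, map_qh_mul_map_qhInv, one_smul]
  have hYl : Commute (x⁻¹ • act₂ V W (Uq.qhInv _)) (act₁ V W (Uq.qhInv _)) :=
    (hc _ _).symm.smul_left _
  have hv' : (Complex.exp η)⁻¹ • ((x⁻¹ • act₂ V W (Uq.qhInv _)) * act₁ V W (Uq.qhInv _)) =
      u * act₁ V W (Uq.qhInv _) := by
    rw [hu, dynParam, ← smul_smul, smul_mul_assoc, smul_mul_assoc, smul_mul_assoc]
  obtain ⟨hN1, hN1u⟩ := nConverges hq (act₁_map_K V W) hXY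
    (by rw [qPowH₂_one_zero]; exact (hc _ _).symm.smul_left _) hYl ((hc _ _).symm.smul_left _)
    (by rw [hv']; exact hv1)
  refine ⟨⟨fun k hk => ?_, ?_⟩, fun k => ?_, ?_, hNV, hNW, hNΔ, hN2, hN1, hN2u, hN1u, ?_⟩
  · rw [tensorAction_pow] at hk
    have hkN : k < Fintype.card (ι × κ) := by
      by_contra hk'
      exact hk (pow_eq_zero_of_le (not_lt.mp hk') (hrel.qcomm_u_eg.pow_card_eq_zero hrel.isUnit ht))
    rw [twistDen_eq]
    exact isUnit_ascProd fun i hi => hden' _ (by omega)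
  · rw [hterm]
    exact summable_of_hasFiniteSupport (hasFiniteSupport_twistSeriesTerm hAnil)
  · rw [twistProdArg_eq]
    exact summable_qExpTerm ((huA.self_pow_mul _).isNilpotent hrel.isUnit ht)
  · rw [twistProdPartial]
    simp only [twistProdArg_eq]
    exact hF
  · have hF' : Tendsto (ascProd fun j => qExp (Complex.exp η)
        (-(Complex.exp η - (Complex.exp η)⁻¹) •
          (act₁ V W (Uq.e _) * (u ^ (2 * j) * act₂ V W (Uq.f _))))) atTop
        (𝓝 (twist V W x)) := by
      refine hF.congr fun m => ?_
      congr 1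
      ext1 j
      rw [hA, mul_smul_comm, ← mul_assoc, ← mul_assoc, (hrel.ue.pow_left _).eq]
    have hΔ' := hNΔ.prod
    rw [NMinusPartial_smul_one (V.tensor W).map_K hx0, ← hul] at hΔ'
    have hΔf : (V.tensor W).toHom (Uq.f _) = _ := actΔ_f V W
    rw [hΔf] at hΔ'
    have hN2' := hN2.prod
    rw [NMinusPartial_smul_one (act₂_map_K V W) hx0] at hN2'
    have hN1' := hN1.prod
    have hpart1 : NMinusPartial (act₁ V W) (x • qPowH₂ V W 1 0) = descProd fun j =>
        qExp (Complex.exp η)⁻¹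
          ((u * act₁ V W (Uq.qhInv _)) ^ (2 * j + 1) * act₁ V W (Uq.f _)) := by
      rw [NMinusPartial]
      congr 1
      ext1 j
      rw [NMinusArg_eq (act₁_map_K V W) hXY hYl, hv']
    rw [hpart1] at hN1'
    -- w is the inverse of u, so -q^{-1} w e is the argument -x q^{h_2} e_1 of the shifted N_+.
    set w := (Complex.exp η * x) • act₂ V W (Uq.qh _) with hw
    have hs : Complex.exp η * x * ((Complex.exp η)⁻¹ * x⁻¹) = 1 := by field_simp
    have huw : u * w = 1 := by
      rw [hu, dynParam, hw, smul_mul_smul_comm, mul_comm, hs, map_qhInv_mul_map_qh, one_smul]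
    have hwu : w * u = 1 := mul_eq_one_comm.mp huw
    have key := hrel.coboundary hq hu1 hv1 huw hwu hF' hΔ' hN1' hN2'
    have harg : -((Complex.exp η)⁻¹ • (w * act₁ V W (Uq.e _))) =
        NPlusArg (act₁ V W) (x • qPowH₂ V W 1 0) := by
      rw [NPlusArg, qPowH₂_one_zero, hw, smul_mul_assoc, smul_mul_assoc, smul_smul,
        inv_mul_cancel_left₀ h0]
    rw [harg] at key
    -- The two summands q^{h_2}e_1 and e_2 of Δ(e) q-commute with factor q^{-2}, so the
    -- q^{-1}-exponential of their sum factorises in this order.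
    have hplus : NPlus (V.tensor W).toHom (x • 1) =
        NPlus (act₁ V W) (x • qPowH₂ V W 1 0) * NPlus (act₂ V W) (x • 1) := by
      have hΔe : (V.tensor W).toHom (Uq.e _) = _ := actΔ_e V W
      have hsum : NPlusArg (V.tensor W).toHom (x • 1) =
          NPlusArg (act₁ V W) (x • qPowH₂ V W 1 0) + NPlusArg (act₂ V W) (x • 1) := by
        rw [NPlusArg, NPlusArg, NPlusArg, hΔe, qPowH₂_one_zero, ← neg_add, smul_mul_assoc,
          smul_mul_assoc, smul_mul_assoc, one_mul, one_mul, smul_add]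
      rw [NPlus, NPlus, NPlus, hsum]
      refine qExp_add hq.inv ?_ ?_ ?_
      · change QComm _ _ _
        rw [NPlusArg, NPlusArg, qPowH₂_one_zero, smul_mul_assoc, smul_mul_assoc, one_mul,
          ← neg_smul, ← neg_smul, inv_pow]
        refine ((QComm.smul_right ?_ _).smul_left _)
        exact ((((Uq.qcomm_qh_e _).map (act₂ V W)).symm (pow_ne_zero 2 h0)).mul_right
          (QComm.of_commute (hc _ _).symm)).of_eq (mul_one _)
      · exact (qcomm_NPlusArg (by rw [qPowH₂_one_zero]; exact (hc _ _).smul_right _)).isNilpotent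
          (isUnit_map_qh _) ht
      · exact (qcomm_NPlusArg ((Commute.one_right _).smul_right _)).isNilpotent
          (isUnit_map_qh _) ht
    have hfin : NΔ V W x = twist V W x * N₁shift V W x * N₂ V W x := by
      rw [NΔ, NElt, hplus, ← mul_assoc, NPlus, key, N₁shift, N₂, NElt, NElt, NPlus, NPlus]
      simp only [mul_assoc]
    have hd2 : IsUnit (N₂ V W x).det := (Matrix.isUnit_iff_isUnit_det _).mp hN2u
    have hd1 : IsUnit (N₁shift V W x).det := (Matrix.isUnit_iff_isUnit_det _).mp hN1u
    rw [hfin, Matrix.mul_nonsing_inv_cancel_right _ _ hd2,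
      Matrix.mul_nonsing_inv_cancel_right _ _ hd1]

end
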